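/- A class $\mathcal C$ of topological spaces is called *compactifiable* if there are metrizable compact spaces $A$, $B$ and a continuous map $q\colon A\to B$ such that every fiber $q^{-1}(b)$, $b\in B$, is homeomorphic to a member of $\mathcal C$ and every member of $\mathcal C$ is homeomorphic to some fiber $q^{-1}(b)$ (neither surjectivity of $q$ nor nonemptiness of $A$, $B$ is required). For a topological space $X$ let $\mathcal K(X)$ be the hyperspace of all compact subsets of $X$ and $\mathcal C(X)\subseteq\mathcal K(X)$ the subspace of all connected ones, both including $\emptyset$ and both with the Vietoris topology; a family $\mathcal F\subseteq\mathcal K(X)$ is regarded as the class of its members with their subspace topologies. A family *contains a copy* of a space $Y$ if some member of it is homeomorphic to $Y$. **Theorem.** Let $(X,d)$ be a compact metric space and for every $n\in\omega$ let $\mathcal A_n$ be a finite covering of $X$ by closed sets of diameter $<2^{-n}$. For $F\in\mathcal K(X)$ put $\mathcal A_n(F)=\bigcup\{A\in\mathcal A_n : A\cap F\neq\emptyset\}$. Every $G_\delta$ family $\mathcal F\subseteq\mathcal K(X)$ that contains a copy of each of the spaces $\mathcal A_n(F)$, $F\in\overline{\mathcal F}$ (closure in $\mathcal K(X)$), $n\in\omega$,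 is compactifiable. **Corollary.** 1. Every analytic subset of $\mathcal C([0,1]^\omega)$ that contains a copy of every Peano continuum (nonempty, connected, locally connected, compact metrizable space) is compactifiable. In particular, the class of all Peano continua is compactifiable. 2. Every analytic subset of $\mathcal K(2^\omega)$ that contains a copy of $2^\omega$ is compactifiable. 3. Let $D_\omega$ be Ważewski's universal dendrite (up to homeomorphism, the unique nondegenerate dendrite in which every branch point has infinite order and every arc contains a branch point). Every $G_\delta$ subset of $\mathcal C(D_\omega)$ that contains a copy of $D_\omega$ is compactifiable. -/

import Mathlib

open Set TopologicalSpace MeasureTheory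

universe u v

/-- Two classes of topological spaces are equivalent if every space of either class is homeomorphic
to a space of the other one. -/
def ClassEquiv (C : Set TopCat.{u}) (D : Set TopCat.{v}) : Prop :=
  (∀ Y ∈ C, ∃ Z ∈ D, Nonempty (Y ≃ₜ Z)) ∧ (∀ Z ∈ D, ∃ Y ∈ C, Nonempty (Y ≃ₜ Z))

/-- A class of topological spaces is compactifiable if there is a continuous map `q : A → B` between
metrizable compacta (possibly empty) whose family of fibers is equivalent to the class. The map `q`
need not be onto, so empty fibers are allowed. -/
def Compactifiable (C : Set TopCat.{u}) : Prop :=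
  ∃ (A B : Type u) (_ : TopologicalSpace A) (_ : CompactSpace A) (_ : MetrizableSpace A)
    (_ : TopologicalSpace B) (_ : CompactSpace B) (_ : MetrizableSpace B) (q : A → B),
    Continuous q ∧ ClassEquiv (range fun b : B => TopCat.of (q ⁻¹' {b})) C

/-- The class of spaces given by a family of compact subsets of `X`, each member being endowed with
the subspace topology. The hyperspace `Compacts X` (which contains the empty set) carries the
Vietoris topology. -/
def spacesOf {X : Type u} [TopologicalSpace X] (F : Set (Compacts X)) : Set TopCat.{u} :=
  (fun K : Compacts X => TopCat.of K) '' F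

/-- The family `F` contains a homeomorphic copy of the space `Y`. -/
def ContainsCopy {X : Type u} [TopologicalSpace X] (F : Set (Compacts X))
    (Y : Type v) [TopologicalSpace Y] : Prop :=
  ∃ K ∈ F, Nonempty (K ≃ₜ Y)

/-- The hyperspace of all subcontinua of `X`, the empty set included. -/
def continua (X : Type u) [TopologicalSpace X] : Set (Compacts X) :=
  {K | IsPreconnected (K : Set X)}

/-- The union of those members of the cover `𝒜` that meet `F`. -/
def coverStar {X : Type u} (𝒜 : Set (Set X)) (F : Set X) : Set X :=
  ⋃₀ {A ∈ 𝒜 | (A ∩ F).Nonempty}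

/-- A Peano continuum: a nonempty, connected, locally connected, metrizable compact space. -/
def IsPeanoContinuum (Y : Type u) [TopologicalSpace Y] : Prop :=
  CompactSpace Y ∧ MetrizableSpace Y ∧ ConnectedSpace Y ∧ LocallyConnectedSpace Y

/-- The Hilbert cube. -/
abbrev HilbertCube : Type := ℕ → unitInterval

/-- The Cantor space. -/
abbrev CantorSpace : Type := ℕ → Bool

/-- The rational numbers strictly between `0` and `1`. -/
abbrev InnerRat : Type := {r : ℚ // 0 < r ∧ r < 1}

/-- Ważewski's universal dendrite `D_ω`, realized in a countable power of the unit interval.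

It is built from countably many arcs, indexed by words `a`: the empty word indexes an initial arc,
and the words `(r, 0) :: a`, `(r, 1) :: a`, … index countably many arcs, with diameters tending to
zero, whose initial points are glued to the point with the rational parameter `r` of the arc with
index `a`. The space is the inverse limit of the dendrites obtained in finitely many steps.
A point `x` of it is given by the list of the parameters `x a`: one runs along the initial arc up to
the parameter `x []`; if that parameter is one of the numbers `r`, one may turn into one of the
arcs `(r, n) :: []` and run along it up to the parameter `x ((r, n) :: [])`, and so on, possibly
infinitely often; `x a = 0` for all arcs `a` that are not entered.

So the branch points are the points with finitely many nonzero parameters, the last of which is a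
rational number strictly between `0` and `1`; each of them has infinite order (its complement has
infinitely many components), and every arc in the space contains one of them. -/
def wazewskiDendrite : Set (List (InnerRat × ℕ) → unitInterval) :=
  {x | ∀ (a : List (InnerRat × ℕ)) (r : InnerRat) (n : ℕ), x ((r, n) :: a) ≠ 0 →
    (x a : ℝ) = ((r : ℚ) : ℝ) ∧ ∀ m : ℕ, m ≠ n → x ((r, m) :: a) = 0}

/-! Everything rests on one criterion, `compactifiable_of_hasCopyNhds`: an analytic family F of
compacta is compactifiable if all members of its closure have arbitrarily small closed neighborhoods
that are copies of members of F. Let F be the image of the Baire space under a continuous f. For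
each σ, choose a decreasing sequence of such neighborhoods that shrinks to f σ, the m-th one
depending only on the first m terms of σ (`approx`, `iInter_approx`). The Baire space sits in the
compact space of sequences in ℕ∞. Over a sequence of finite terms put f σ; over a sequence whose
first infinite term has index m put the m-th neighborhood. The resulting relation is closed, since
finite terms are isolated in ℕ∞, and its projection to the space of sequences is the required map.
An initial neighborhood common to all values of f is needed, so this is done near each point of the
closure of F; by compactness finitely many pieces suffice, and the disjoint sum of their maps serves
all of F.

It remains to find neighborhoods. The stars of K in fine closed covers are small neighborhoods by
definition. In the Cantor space, nonempty clopen sets are Cantor sets. In the Hilbert cube, a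
continuum is covered by finitely many small boxes, whose union is a Peano continuum; the family of
all Peano continua is analytic by Sierpiński's property S. In the dendrite, a subcontinuum is
determined by bounds on the parameters; finitely many rational bounds cut out a small neighborhood,
and rescaling all parameters affinely identifies it with the whole dendrite
(`exists_wazewskiDendrite_nhd`). Continua form a closed family, so limits of continua are covered as
well. -/

/-- There is a continuous map between metrizable compacta all of whose fibers are copies of members
of `F`, and among whose fibers there are copies of all members of `F'`. -/
def FiberRealizable {X : Type u} [TopologicalSpace X] (F' F : Set (Compacts X)) : Prop :=
  ∃ (A B : Type u) (_ : TopologicalSpace A) (_ : CompactSpace A) (_ : MetrizableSpace A)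
    (_ : TopologicalSpace B) (_ : CompactSpace B) (_ : MetrizableSpace B) (q : A → B),
    Continuous q ∧ (∀ b, ContainsCopy F (q ⁻¹' {b})) ∧
      ∀ K ∈ F', ∃ b, Nonempty (q ⁻¹' {b} ≃ₜ K)

/-! ### Partial realizations by fibers and their sums -/

section FiberRealizable

variable {X : Type u} [TopologicalSpace X] {F F₁ F₂ : Set (Compacts X)}

theorem FiberRealizable.compactifiable (h : FiberRealizable F F) :
    Compactifiable (spacesOf F) := by
  obtain ⟨A, B, i1, i2, i3, i4, i5, i6, q, hq, h1, h2⟩ := h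
  refine ⟨A, B, i1, i2, i3, i4, i5, i6, q, hq, ?_, ?_⟩
  · rintro _ ⟨b, rfl⟩
    obtain ⟨K, hK, ⟨e⟩⟩ := h1 b
    exact ⟨_, ⟨K, hK, rfl⟩, ⟨e.symm⟩⟩
  · rintro _ ⟨K, hK, rfl⟩
    obtain ⟨b, hb⟩ := h2 K hK
    exact ⟨_, ⟨b, rfl⟩, hb⟩

theorem FiberRealizable.mono (h : FiberRealizable F₂ F) (h12 : F₁ ⊆ F₂) : FiberRealizable F₁ F := by
  obtain ⟨A, B, i1, i2, i3, i4, i5, i6, q, hq, h1, h2⟩ := h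
  exact ⟨A, B, i1, i2, i3, i4, i5, i6, q, hq, h1, fun K hK => h2 K (h12 hK)⟩

theorem FiberRealizable.empty : FiberRealizable ∅ F :=
  ⟨PEmpty, PEmpty, inferInstance, inferInstance, inferInstance, inferInstance, inferInstance,
    inferInstance, id, continuous_id, fun b => b.elim, fun _ h => h.elim⟩

theorem metrizableSpace_sum_of_compactSpace (A₁ A₂ : Type*) [TopologicalSpace A₁]
    [TopologicalSpace A₂] [CompactSpace A₁] [CompactSpace A₂] [MetrizableSpace A₁]
    [MetrizableSpace A₂] : MetrizableSpace (A₁ ⊕ A₂) := by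
  let := metrizableSpaceMetric A₁
  let := metrizableSpaceMetric A₂
  let : MetricSpace (A₁ ⊕ A₂) := Metric.metricSpaceSum
  infer_instance

/-- Over the left summand, the fibers of a sum of two maps are those of the first map. -/
noncomputable def sumMapFiberInl {A₁ A₂ B₁ B₂ : Type*} [TopologicalSpace A₁] [TopologicalSpace A₂]
    (q₁ : A₁ → B₁) (q₂ : A₂ → B₂) (b : B₁) :
    (Sum.map q₁ q₂ ⁻¹' {Sum.inl b}) ≃ₜ (q₁ ⁻¹' {b}) :=
  (((Topology.IsEmbedding.inl (X := A₁) (Y := A₂)).homeomorphImage (q₁ ⁻¹' {b})).trans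
    (Homeomorph.setCongr (by ext (x | x) <;> simp))).symm

/-- Over the right summand, the fibers of a sum of two maps are those of the second map. -/
noncomputable def sumMapFiberInr {A₁ A₂ B₁ B₂ : Type*} [TopologicalSpace A₁] [TopologicalSpace A₂]
    (q₁ : A₁ → B₁) (q₂ : A₂ → B₂) (b : B₂) :
    (Sum.map q₁ q₂ ⁻¹' {Sum.inr b}) ≃ₜ (q₂ ⁻¹' {b}) :=
  (((Topology.IsEmbedding.inr (X := A₁) (Y := A₂)).homeomorphImage (q₂ ⁻¹' {b})).trans
    (Homeomorph.setCongr (by ext (x | x) <;> simp))).symm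

theorem FiberRealizable.union (h₁ : FiberRealizable F₁ F) (h₂ : FiberRealizable F₂ F) :
    FiberRealizable (F₁ ∪ F₂) F := by
  obtain ⟨A₁, B₁, _, _, _, _, _, _, q₁, hq₁, hc₁, hs₁⟩ := h₁
  obtain ⟨A₂, B₂, _, _, _, _, _, _, q₂, hq₂, hc₂, hs₂⟩ := h₂
  refine ⟨A₁ ⊕ A₂, B₁ ⊕ B₂, inferInstance, inferInstance,
    metrizableSpace_sum_of_compactSpace _ _, inferInstance, inferInstance,
    metrizableSpace_sum_of_compactSpace _ _, Sum.map q₁ q₂, hq₁.sumMap hq₂, ?_, ?_⟩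
  · rintro (b | b)
    · obtain ⟨K, hK, ⟨e⟩⟩ := hc₁ b
      exact ⟨K, hK, ⟨e.trans (sumMapFiberInl q₁ q₂ b).symm⟩⟩
    · obtain ⟨K, hK, ⟨e⟩⟩ := hc₂ b
      exact ⟨K, hK, ⟨e.trans (sumMapFiberInr q₁ q₂ b).symm⟩⟩
  · rintro K (hK | hK)
    · obtain ⟨b, ⟨e⟩⟩ := hs₁ K hK
      exact ⟨Sum.inl b, ⟨(sumMapFiberInl q₁ q₂ b).trans e⟩⟩
    · obtain ⟨b, ⟨e⟩⟩ := hs₂ K hK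
      exact ⟨Sum.inr b, ⟨(sumMapFiberInr q₁ q₂ b).trans e⟩⟩

theorem MetrizableSpace.ulift (X : Type u) [TopologicalSpace X] [MetrizableSpace X] :
    MetrizableSpace (ULift.{v} X) :=
  Homeomorph.ulift.isEmbedding.metrizableSpace

/-- A closed subset of a product with a metrizable compactum realizes its vertical sections. -/
theorem FiberRealizable.of_isClosed {X : Type u} [TopologicalSpace X] [CompactSpace X]
    [MetrizableSpace X] {F F' : Set (Compacts X)} {B : Type} [TopologicalSpace B] [CompactSpace B]
    [MetrizableSpace B] (R : Set (B × X)) (hR : IsClosed R)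
    (hc : ∀ b, ContainsCopy F {x | (b, x) ∈ R})
    (hs : ∀ K ∈ F', ∃ b, {x | (b, x) ∈ R} = (K : Set X)) : FiberRealizable F' F := by
  have : CompactSpace R := isCompact_iff_compactSpace.1 hR.isCompact
  -- The base is lifted because `FiberRealizable` asks for total space and base in the universe of
  -- `X`.
  have := MetrizableSpace.ulift.{0, u} B
  let q : R → ULift.{u} B := fun z => ULift.up z.1.1
  have hq : Continuous q := by fun_prop
  let e : ∀ b : ULift.{u} B, {x | (b.down, x) ∈ R} ≃ₜ q ⁻¹' {b} := fun b =>
    { toFun := fun x => ⟨⟨(b.down, x.1), x.2⟩, rfl⟩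
      invFun := fun z => ⟨z.1.1.2, by
        obtain ⟨⟨⟨c, x⟩, hz⟩, rfl⟩ := z
        exact hz⟩
      left_inv := fun x => rfl
      right_inv := by
        rintro ⟨⟨⟨c, x⟩, hz⟩, rfl⟩
        rfl
      continuous_toFun := by fun_prop
      continuous_invFun := by fun_prop }
  refine ⟨R, ULift.{u} B, inferInstance, inferInstance, inferInstance, inferInstance,
    inferInstance, inferInstance, q, hq, fun b => ?_, fun K hK => ?_⟩
  · obtain ⟨K, hK, ⟨h⟩⟩ := hc b.down
    exact ⟨K, hK, ⟨h.trans (e b)⟩⟩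
  · obtain ⟨b, hb⟩ := hs K hK
    exact ⟨ULift.up b, ⟨(e (ULift.up b)).symm.trans (Homeomorph.setCongr hb)⟩⟩

end FiberRealizable

/-! ### Approximation along the Baire space and the compactified relation -/

section Core

open PiNat Metric Topology

variable {X : Type u} [MetricSpace X] {F : Set (Compacts X)}

/-- The pair `s'` is a better common approximation of the compacta `f τ`, `τ ∈ C`, than `s`: its
first component is a smaller closed neighborhood of all of them that is a copy of a member of `F`,
and the precision expressed by the second component is higher. -/
def Improves (F : Set (Compacts X)) (f : (ℕ → ℕ) → Compacts X) (C : Set (ℕ → ℕ))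
    (s s' : Set X × ℕ) : Prop :=
  IsClosed s'.1 ∧ ContainsCopy F s'.1 ∧ s'.1 ⊆ s.1 ∧ s.2 < s'.2 ∧
    ∀ τ ∈ C, (f τ : Set X) ⊆ interior s'.1 ∧ s'.1 ⊆ thickening (1 / ((s'.2 : ℝ) + 1)) (f τ)

open Classical in
/-- The successive approximations of the compacta `f τ` where `τ` runs through the cylinders at `σ`,
starting with `P`. The approximation is replaced by a better one whenever there is one. -/
noncomputable def approx (F : Set (Compacts X)) (f : (ℕ → ℕ) → Compacts X) (P : Set X)
    (σ : ℕ → ℕ) : ℕ → Set X × ℕ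
  | 0 => (P, 0)
  | m + 1 =>
    if h : ∃ s', Improves F f (cylinder σ (m + 1)) (approx F f P σ m) s' then h.choose
    else approx F f P σ m

variable {f : (ℕ → ℕ) → Compacts X} {P : Set X}

theorem approx_succ_cases (F : Set (Compacts X)) (f : (ℕ → ℕ) → Compacts X) (P : Set X)
    (σ : ℕ → ℕ) (m : ℕ) :
    Improves F f (cylinder σ (m + 1)) (approx F f P σ m) (approx F f P σ (m + 1)) ∨
      approx F f P σ (m + 1) = approx F f P σ m := by
  by_cases h : ∃ s', Improves F f (cylinder σ (m + 1)) (approx F f P σ m) s'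
  · left
    rw [approx, dif_pos h]
    exact h.choose_spec
  · right
    rw [approx, dif_neg h]

theorem approx_succ_of_exists {σ : ℕ → ℕ} {m : ℕ}
    (h : ∃ s', Improves F f (cylinder σ (m + 1)) (approx F f P σ m) s') :
    (approx F f P σ m).2 < (approx F f P σ (m + 1)).2 := by
  rw [approx, dif_pos h]
  exact h.choose_spec.2.2.2.1

/-- Stage `m + 1` consults `σ` only through its cylinder of length `m + 1`. Hence the `m`-th
approximation still makes sense when the term with index `m` becomes infinite. -/
theorem approx_congr {σ τ : ℕ → ℕ} {m : ℕ} (h : ∀ i < m, σ i = τ i) :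
    approx F f P σ m = approx F f P τ m := by
  induction m with
  | zero => rfl
  | succ m ih =>
    have hc : cylinder σ (m + 1) = cylinder τ (m + 1) := mem_cylinder_iff_eq.1 h
    rw [approx, approx, ih fun i hi => h i (hi.trans m.lt_succ_self), hc]

theorem approx_antitone (F : Set (Compacts X)) (f : (ℕ → ℕ) → Compacts X) (P : Set X)
    (σ : ℕ → ℕ) : Antitone fun m => (approx F f P σ m).1 :=
  antitone_nat_of_succ_le fun m => by
    rcases approx_succ_cases F f P σ m with h | h
    · exact h.2.2.1
    · simp [h]

theorem approx_level_monotone (F : Set (Compacts X)) (f : (ℕ → ℕ) → Compacts X) (P : Set X)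
    (σ : ℕ → ℕ) : Monotone fun m => (approx F f P σ m).2 :=
  monotone_nat_of_le_succ fun m => by
    rcases approx_succ_cases F f P σ m with h | h
    · exact h.2.2.2.1.le
    · simp [h]

/-- Level `0` is excluded from the last clause: the starting set `P` need not be close to `f σ`. -/
theorem approx_spec (hP : IsClosed P) (hPF : ContainsCopy F P)
    (hfP : ∀ σ, (f σ : Set X) ⊆ interior P) (σ : ℕ → ℕ) (m : ℕ) :
    IsClosed (approx F f P σ m).1 ∧ ContainsCopy F (approx F f P σ m).1 ∧
      (f σ : Set X) ⊆ interior (approx F f P σ m).1 ∧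
      (0 < (approx F f P σ m).2 →
        (approx F f P σ m).1 ⊆ thickening (1 / (((approx F f P σ m).2 : ℝ) + 1)) (f σ)) := by
  induction m with
  | zero => exact ⟨hP, hPF, hfP σ, fun h => absurd h (lt_irrefl 0)⟩
  | succ m ih =>
    rcases approx_succ_cases F f P σ m with h | h
    · exact ⟨h.1, h.2.1, (h.2.2.2.2 σ (self_mem_cylinder _ _)).1,
        fun _ => (h.2.2.2.2 σ (self_mem_cylinder _ _)).2⟩
    · rwa [h]

/-- Closed neighborhoods of a compact set `K` near `K` approximate all compact sets close to `K`. -/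
theorem eventually_subset_interior_and_subset_thickening {K : Compacts X} {P : Set X} {ε : ℝ}
    (hε : 0 < ε) (hK : (K : Set X) ⊆ interior P) (hP : P ⊆ thickening (ε / 2) (K : Set X)) :
    ∀ᶠ L : Compacts X in 𝓝 K, (L : Set X) ⊆ interior P ∧ P ⊆ thickening ε (L : Set X) := by
  have h1 : ∀ᶠ L : Compacts X in 𝓝 K, (L : Set X) ⊆ interior P :=
    (Compacts.isOpen_subsets_of_isOpen isOpen_interior).mem_nhds hK
  -- A finite `ε / 4`-net of `K`: a point of `P` is within `ε / 2` of `K`, then `ε / 4` from there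
  -- to the net, and `ε / 4` from the net to `L`.
  obtain ⟨t, htK, htf, ht⟩ := finite_cover_balls_of_compact K.isCompact (e := ε / 4) (by positivity)
  have h2 : ∀ᶠ L : Compacts X in 𝓝 K, ∀ x ∈ t, ((L : Set X) ∩ ball x (ε / 4)).Nonempty := by
    rw [htf.eventually_all]
    intro x hx
    exact (Compacts.isOpen_inter_nonempty_of_isOpen isOpen_ball).mem_nhds
      ⟨x, htK hx, mem_ball_self (by positivity)⟩
  filter_upwards [h1, h2] with L hL1 hL2
  refine ⟨hL1, fun x hx => ?_⟩
  obtain ⟨y, hyK, hxy⟩ := mem_thickening_iff.1 (hP hx)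
  obtain ⟨z, hz, hyz⟩ := mem_iUnion₂.1 (ht hyK)
  obtain ⟨w, hwL, hwz⟩ := hL2 z hz
  refine mem_thickening_iff.2 ⟨w, hwL, ?_⟩
  have h3 := dist_triangle4 x y z w
  rw [mem_ball] at hyz hwz
  rw [dist_comm z w] at h3
  linarith

/-- The family `F` contains copies of arbitrarily small closed neighborhoods of `K`. -/
def HasCopyNhds {X : Type u} [TopologicalSpace X] (F : Set (Compacts X)) (K : Set X) : Prop :=
  ∀ U : Set X, IsOpen U → K ⊆ U →
    ∃ P : Set X, IsClosed P ∧ K ⊆ interior P ∧ P ⊆ U ∧ ContainsCopy F P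

/-- If the level stopped at `N`, the approximation would be constant from some stage on. A small
copy around `f σ` inside it works, by continuity of `f`, for a whole cylinder at `σ`; once the stage
reaches the length of that cylinder, an improvement exists and the level must grow. -/
theorem exists_le_approx_level (hf : Continuous f) (hP : IsClosed P) (hPF : ContainsCopy F P)
    (hfP : ∀ σ, (f σ : Set X) ⊆ interior P) (σ : ℕ → ℕ) (hσ : HasCopyNhds F (f σ : Set X))
    (N : ℕ) : ∃ m, N ≤ (approx F f P σ m).2 := by
  induction N with
  | zero => exact ⟨0, Nat.zero_le _⟩
  | succ N ih =>
    obtain ⟨m, hm⟩ := ih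
    by_contra! hcon
    have hlev : ∀ k, (approx F f P σ (m + k)).2 = N := fun k =>
      le_antisymm (Nat.lt_succ_iff.1 (hcon _))
        (hm.trans (approx_level_monotone F f P σ (Nat.le_add_right m k)))
    have hconst : ∀ k, approx F f P σ (m + k) = approx F f P σ m := by
      intro k
      induction k with
      | zero => rfl
      | succ k ihk =>
        rcases approx_succ_cases F f P σ (m + k) with h | h
        · have h1 := h.2.2.2.1
          rw [← add_assoc] at *
          have h2 := hlev k
          have h3 := hlev (k + 1)
          rw [← add_assoc] at h3
          omega
        · rw [← add_assoc, h, ihk]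
    set ε : ℝ := 1 / (((N + 1 : ℕ) : ℝ) + 1) with hε
    have hε0 : 0 < ε := by positivity
    obtain ⟨Q, hQc, hQi, hQU, hQF⟩ := hσ
      (interior (approx F f P σ m).1 ∩ thickening (ε / 2) (f σ : Set X))
      (isOpen_interior.inter isOpen_thickening)
      (subset_inter (approx_spec hP hPF hfP σ m).2.2.1
        (self_subset_thickening (by positivity) _))
    have hev := hf.continuousAt.eventually (eventually_subset_interior_and_subset_thickening hε0 hQi
      (hQU.trans inter_subset_right))
    obtain ⟨_, ⟨τ, n, rfl⟩, hστ, hn⟩ :=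
      (isTopologicalBasis_cylinders fun _ : ℕ => ℕ).mem_nhds_iff.1 hev
    rw [mem_cylinder_iff_eq.1 hστ |>.symm] at hn
    -- Stage `m + n + 1` is late enough both for the approximation to be constant and for its
    -- cylinder to lie in the one of length `n`.
    have := approx_succ_of_exists (F := F) (f := f) (P := P) (σ := σ) (m := m + n)
      ⟨(Q, N + 1), hQc, hQF, by
        rw [hconst]
        exact hQU.trans (inter_subset_left.trans interior_subset), by
        rw [hlev]
        exact Nat.lt_succ_self N, fun τ hτ =>
          hn (cylinder_anti σ (show n ≤ m + n + 1 by omega) hτ)⟩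
    have h2 := hlev n
    have h3 := hlev (n + 1)
    rw [← add_assoc] at h3
    omega

theorem iInter_approx (hf : Continuous f) (hP : IsClosed P) (hPF : ContainsCopy F P)
    (hfP : ∀ σ, (f σ : Set X) ⊆ interior P) (σ : ℕ → ℕ) (hσ : HasCopyNhds F (f σ : Set X)) :
    ⋂ m, (approx F f P σ m).1 = (f σ : Set X) := by
  refine Subset.antisymm (fun x hx => ?_)
    (subset_iInter fun m => (approx_spec hP hPF hfP σ m).2.2.1.trans interior_subset)
  rw [← (f σ).isCompact.isClosed.closure_eq, Metric.mem_closure_iff]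
  intro ε hε
  obtain ⟨n, hn⟩ := exists_nat_one_div_lt hε
  -- Level `n + 1` instead of `n` guarantees a positive level, where the metric estimate is
  -- available.
  obtain ⟨m, hm⟩ := exists_le_approx_level hf hP hPF hfP σ hσ (n + 1)
  obtain ⟨y, hy, hxy⟩ := mem_thickening_iff.1
    ((approx_spec hP hPF hfP σ m).2.2.2 (by omega) (mem_iInter.1 hx m))
  refine ⟨y, hy, hxy.trans_le (le_trans ?_ hn.le)⟩
  apply one_div_le_one_div_of_le (by positivity)
  have : n ≤ (approx F f P σ m).2 := by omega
  gcongr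

/-- The closed relation whose section over a sequence of natural numbers `σ` is `f σ` and whose
section over an extended sequence with infinite terms is the approximation given by the terms before
the first infinite one. -/
theorem isClosed_setOf_mem_approx (hP : IsClosed P) (hPF : ContainsCopy F P)
    (hfP : ∀ σ, (f σ : Set X) ⊆ interior P) :
    IsClosed {z : (ℕ → ℕ∞) × X | ∀ m, (∀ i < m, z.1 i ≠ ⊤) →
      z.2 ∈ (approx F f P (fun i => (z.1 i).toNat) m).1} := by
  rw [ofPred_forall]
  refine isClosed_iInter fun m => isOpen_compl_iff.1 (isOpen_iff_mem_nhds.2 ?_)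
  rintro ⟨b, x⟩ hz
  simp only [mem_compl_iff, mem_ofPred_eq, Classical.not_imp] at hz
  obtain ⟨hb, hx⟩ := hz
  have hc := (approx_spec hP hPF hfP (fun i => (b i).toNat) m).1
  -- A violated condition involves only finitely many finite terms of `b`. These are isolated in ℕ∞,
  -- so nearby sequences share them and violate the same condition.
  have h1 : ∀ᶠ c : ℕ → ℕ∞ in 𝓝 b, ∀ i ∈ Iio m, c i = b i := by
    rw [(finite_Iio m).eventually_all]
    intro i hi
    exact (continuous_apply i).continuousAt.eventually
      ((ENat.isOpen_singleton (hb i hi)).mem_nhds rfl)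
  rw [nhds_prod_eq]
  filter_upwards [h1.prod_mk (hc.isOpen_compl.mem_nhds hx)] with z ⟨hz1, hz2⟩
  simp only [mem_compl_iff, mem_ofPred_eq, Classical.not_imp]
  refine ⟨fun i hi => by rw [hz1 i hi]; exact hb i hi, ?_⟩
  rw [approx_congr (τ := fun i => (b i).toNat) fun i hi => by rw [hz1 i hi]]
  exact hz2

theorem fiberRealizable_range [CompactSpace X] (hf : Continuous f) (hP : IsClosed P)
    (hPF : ContainsCopy F P) (hfP : ∀ σ, (f σ : Set X) ⊆ interior P) (hfF : ∀ σ, f σ ∈ F)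
    (h : ∀ K ∈ F, HasCopyNhds F (K : Set X)) : FiberRealizable (range f) F := by
  classical
  have hfin : ∀ b : ℕ → ℕ∞, (∀ i, b i ≠ ⊤) →
      {x | (b, x) ∈ {z : (ℕ → ℕ∞) × X | ∀ m, (∀ i < m, z.1 i ≠ ⊤) →
        z.2 ∈ (approx F f P (fun i => (z.1 i).toNat) m).1}} =
        (f fun i => (b i).toNat : Set X) := by
    intro b hb
    rw [← iInter_approx hf hP hPF hfP _ (h _ (hfF _))]
    ext x
    simp [hb]
  refine FiberRealizable.of_isClosed _ (isClosed_setOf_mem_approx hP hPF hfP) (fun b => ?_) ?_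
  · by_cases hb : ∀ i, b i ≠ ⊤
    · rw [hfin b hb]
      exact ⟨_, hfF _, ⟨Homeomorph.refl _⟩⟩
    · push Not at hb
      have hlt : ∀ i < Nat.find hb, b i ≠ ⊤ := fun i hi => Nat.find_min hb hi
      -- Only the conditions up to the first infinite term are active, and the approximations
      -- decrease, so the last active one is the whole section.
      have : {x | (b, x) ∈ {z : (ℕ → ℕ∞) × X | ∀ m, (∀ i < m, z.1 i ≠ ⊤) →
          z.2 ∈ (approx F f P (fun i => (z.1 i).toNat) m).1}} =
          (approx F f P (fun i => (b i).toNat) (Nat.find hb)).1 := by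
        ext x
        simp only [mem_ofPred_eq]
        refine ⟨fun hx => hx _ hlt, fun hx m hm => ?_⟩
        refine approx_antitone F f P _ ?_ hx
        by_contra! hlt'
        exact hm _ hlt' (Nat.find_spec hb)
      rw [this]
      exact (approx_spec hP hPF hfP _ _).2.1
  · rintro _ ⟨σ, rfl⟩
    exact ⟨fun i => (σ i : ℕ∞), by rw [hfin _ fun i => ENat.natCast_ne_top _]; simp⟩

end Core

/-- An analytic family of compacta in a metrizable compactum that contains copies of arbitrarily
small closed neighborhoods of all members of its closure is compactifiable. -/
theorem compactifiable_of_hasCopyNhds {X : Type u} [TopologicalSpace X] [CompactSpace X]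
    [MetrizableSpace X] {F : Set (Compacts X)} (hF : AnalyticSet F)
    (h : ∀ K ∈ closure F, HasCopyNhds F (K : Set X)) : Compactifiable (spacesOf F) := by
  let _ := metrizableSpaceMetric X
  have hloc : ∀ K ∈ closure F, ∃ t ∈ nhdsWithin K (closure F), FiberRealizable (F ∩ t) F := by
    intro K hK
    -- No smallness is needed here: `P` is only the common starting set for all members of `F` near
    -- `K`.
    obtain ⟨P, hP, hKP, -, hPF⟩ := h K hK univ isOpen_univ (subset_univ _)
    have hO := Compacts.isOpen_subsets_of_isOpen (isOpen_interior (s := P))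
    refine ⟨{L | (L : Set X) ⊆ interior P}, mem_nhdsWithin_of_mem_nhds (hO.mem_nhds hKP), ?_⟩
    have hFO : AnalyticSet (F ∩ {L | (L : Set X) ⊆ interior P}) := by
      rw [AnalyticSet] at hF
      obtain rfl | ⟨f, hf, rfl⟩ := hF
      · simpa using analyticSet_empty
      · rw [inter_comm, ← image_preimage_eq_inter_range]
        exact (hO.preimage hf).analyticSet_image hf
    rw [AnalyticSet] at hFO
    obtain h0 | ⟨f, hf, hfr⟩ := hFO
    · rw [h0]
      exact FiberRealizable.empty
    · have hfm : ∀ σ, f σ ∈ F ∩ {L | (L : Set X) ⊆ interior P} := fun σ => hfr ▸ mem_range_self σ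
      rw [← hfr]
      exact fiberRealizable_range hf hP hPF (fun σ => (hfm σ).2) (fun σ => (hfm σ).1)
        fun K hK => h K (subset_closure hK)
  have := isClosed_closure.isCompact.induction_on (p := fun t => FiberRealizable (F ∩ t) F)
    (by simpa using FiberRealizable.empty)
    (fun s t hst ht => ht.mono (inter_subset_inter_right F hst))
    (fun s t hs ht => by rw [inter_union_distrib_left]; exact hs.union ht) hloc
  rw [inter_eq_self_of_subset_left subset_closure] at this
  exact this.compactifiable

/-! ### Stars in fine closed covers -/

section CoverStar

variable {X : Type u}

theorem isClosed_coverStar [TopologicalSpace X] {𝒜 : Set (Set X)} (hfin : 𝒜.Finite)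
    (hcl : ∀ A ∈ 𝒜, IsClosed A) (K : Set X) : IsClosed (coverStar 𝒜 K) := by
  rw [coverStar, sUnion_eq_biUnion]
  exact (hfin.subset (sep_subset _ _)).isClosed_biUnion fun A hA => hcl A hA.1

/-- The members of the cover that miss `K` have a closed union; its complement is open, contains `K`
and lies in the star. -/
theorem subset_interior_coverStar [TopologicalSpace X] {𝒜 : Set (Set X)} (hfin : 𝒜.Finite)
    (hcl : ∀ A ∈ 𝒜, IsClosed A) (hcov : ⋃₀ 𝒜 = univ) (K : Set X) :
    K ⊆ interior (coverStar 𝒜 K) := by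
  have hc : IsClosed (⋃₀ {A ∈ 𝒜 | ¬(A ∩ K).Nonempty}) := by
    rw [sUnion_eq_biUnion]
    exact (hfin.subset (sep_subset _ _)).isClosed_biUnion fun A hA => hcl A hA.1
  refine subset_trans ?_ (interior_maximal (t := (⋃₀ {A ∈ 𝒜 | ¬(A ∩ K).Nonempty})ᶜ) ?_
    hc.isOpen_compl)
  · rintro x hx ⟨A, ⟨-, hA⟩, hxA⟩
    exact hA ⟨x, hxA, hx⟩
  · intro x hx
    obtain ⟨A, hA, hxA⟩ := mem_sUnion.1 (hcov ▸ mem_univ x)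
    by_contra hcon
    exact hx ⟨A, ⟨hA, fun h => hcon ⟨A, ⟨hA, h⟩, hxA⟩⟩, hxA⟩

theorem coverStar_subset_thickening [MetricSpace X] [CompactSpace X] {𝒜 : Set (Set X)} {δ : ℝ}
    (hd : ∀ A ∈ 𝒜, Metric.diam A < δ) (K : Set X) :
    coverStar 𝒜 K ⊆ Metric.thickening δ K := by
  rintro x ⟨A, ⟨hA, y, hyA, hyK⟩, hxA⟩
  exact Metric.mem_thickening_iff.2 ⟨y, hyK,
    (Metric.dist_le_diam_of_mem (Metric.isBounded_of_compactSpace) hxA hyA).trans_lt (hd A hA)⟩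

theorem compactifiable_of_coverStar [MetricSpace X] [CompactSpace X] (𝒜 : ℕ → Set (Set X))
    (hfin : ∀ n, (𝒜 n).Finite)
    (hcl : ∀ n, ∀ A ∈ 𝒜 n, IsClosed A ∧ Metric.diam A < (2 : ℝ)⁻¹ ^ n)
    (hcov : ∀ n, ⋃₀ 𝒜 n = univ) (F : Set (Compacts X)) (hF : AnalyticSet F)
    (h : ∀ K ∈ closure F, ∀ n, ContainsCopy F (coverStar (𝒜 n) (K : Set X))) :
    Compactifiable (spacesOf F) := by
  refine compactifiable_of_hasCopyNhds hF fun K hK U hU hKU => ?_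
  obtain ⟨δ, hδ, hδU⟩ := K.isCompact.exists_thickening_subset_open hU hKU
  obtain ⟨n, hn⟩ := exists_pow_lt_of_lt_one hδ (show (2 : ℝ)⁻¹ < 1 by norm_num)
  exact ⟨coverStar (𝒜 n) K, isClosed_coverStar (hfin n) (fun A hA => (hcl n A hA).1) _,
    subset_interior_coverStar (hfin n) (fun A hA => (hcl n A hA).1) (hcov n) _,
    (coverStar_subset_thickening (fun A hA => ((hcl n A hA).2.trans hn)) _).trans hδU, h K hK n⟩

end CoverStar

theorem IsGδ.analyticSet {Z : Type*} [TopologicalSpace Z] [PolishSpace Z] {s : Set Z}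
    (hs : IsGδ s) : AnalyticSet s := by
  borelize Z
  exact hs.measurableSet.analyticSet

theorem polishSpace_compacts (X : Type u) [TopologicalSpace X] [CompactSpace X]
    [MetrizableSpace X] : PolishSpace (Compacts X) := by
  let _ := metrizableSpaceMetric X
  infer_instance

/-- The empty set is isolated in the hyperspace, so that only nonempty limits of a family have to be
considered. -/
theorem hasCopyNhds_of_nonempty {X : Type u} [TopologicalSpace X] {F : Set (Compacts X)}
    {K : Compacts X} (hK : K ∈ closure F)
    (h : (K : Set X).Nonempty → HasCopyNhds F (K : Set X)) : HasCopyNhds F (K : Set X) := by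
  obtain hne | hne := (K : Set X).eq_empty_or_nonempty.symm
  · exact h hne
  · have hbot : K = ⊥ := SetLike.coe_injective (by simpa using hne)
    subst hbot
    obtain ⟨L, hL, hLF⟩ := mem_closure_iff.1 hK {⊥} Compacts.isClopen_singleton_bot.isOpen rfl
    rw [mem_singleton_iff.1 hL] at hLF
    exact fun U _ _ => ⟨∅, isClosed_empty, by simp, empty_subset U, ⊥, hLF,
      ⟨Homeomorph.setCongr (by simp)⟩⟩

/-! ### Clopen neighborhoods in the Cantor space -/

section Cantor

/-- Prepending a bit. -/
def boolProdCantor : Bool × CantorSpace ≃ₜ CantorSpace where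
  toFun z := fun n => Nat.casesOn n z.1 z.2
  invFun x := (x 0, fun n => x (n + 1))
  left_inv z := rfl
  right_inv x := by
    funext n
    cases n <;> rfl
  continuous_toFun := by
    refine continuous_pi fun n => ?_
    cases n with
    | zero => exact continuous_fst
    | succ n => exact (continuous_apply n).comp continuous_snd
  continuous_invFun := by fun_prop

/-- In the inductive step, the first `k + 1` copies merge into one by induction, and two Cantor sets
form one by prepending a bit. -/
theorem nonempty_finProd_homeomorph_cantor (k : ℕ) :
    Nonempty (Fin (k + 1) × CantorSpace ≃ₜ CantorSpace) := by
  induction k with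
  | zero => exact ⟨Homeomorph.uniqueProd (Fin 1) CantorSpace⟩
  | succ k ih =>
    obtain ⟨e⟩ := ih
    let e1 : Fin (k + 1) ⊕ Fin 1 ≃ₜ Fin (k + 2) := finSumFinEquiv.toHomeomorphOfDiscrete
    let e2 : Fin 1 ⊕ Fin 1 ≃ₜ Bool :=
      (finSumFinEquiv.trans finTwoEquiv).toHomeomorphOfDiscrete
    exact ⟨(e1.symm.prodCongr (Homeomorph.refl _)).trans <|
      (Homeomorph.sumProdDistrib).trans <|
      ((e.trans (Homeomorph.uniqueProd (Fin 1) CantorSpace).symm).sumCongr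
        (Homeomorph.refl _)).trans <|
      Homeomorph.sumProdDistrib.symm.trans <|
      (e2.prodCongr (Homeomorph.refl _)).trans boolProdCantor⟩

theorem nonempty_prod_homeomorph_cantor (S : Type*) [TopologicalSpace S] [DiscreteTopology S]
    [Finite S] [Nonempty S] : Nonempty (S × CantorSpace ≃ₜ CantorSpace) := by
  obtain ⟨n, ⟨e⟩⟩ := Finite.exists_equiv_fin S
  obtain ⟨k, rfl⟩ : ∃ k, n = k + 1 :=
    Nat.exists_eq_succ_of_ne_zero fun h => by subst h; exact (e (Classical.arbitrary S)).elim0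
  obtain ⟨e'⟩ := nonempty_finProd_homeomorph_cantor k
  exact ⟨(e.toHomeomorphOfDiscrete.prodCongr (Homeomorph.refl _)).trans e'⟩

/-- A set given by a set of possible initial segments is the product of the latter with the Cantor
space. -/
def prefixSetHomeomorph (n : ℕ) (S : Set (Fin n → Bool)) :
    {x : CantorSpace | (fun i : Fin n => x i) ∈ S} ≃ₜ S × CantorSpace where
  toFun x := (⟨fun i => x.1 i, x.2⟩, fun m => x.1 (m + n))
  invFun z := ⟨fun m => if h : m < n then z.1.1 ⟨m, h⟩ else z.2 (m - n), by simp⟩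
  left_inv x := by
    ext m
    by_cases h : m < n
    · simp [h]
    · simp [h, Nat.sub_add_cancel (not_lt.1 h)]
  right_inv z := by simp
  continuous_toFun := by
    refine (Continuous.subtype_mk (continuous_pi fun i => ?_) _).prodMk (continuous_pi fun m => ?_)
    · exact (continuous_apply i.1).comp continuous_subtype_val
    · exact (continuous_apply (m + n)).comp continuous_subtype_val
  continuous_invFun := by
    refine Continuous.subtype_mk (continuous_pi fun m => ?_) _
    by_cases h : m < n
    · simp only [h, dite_true]
      exact (continuous_apply _).comp (continuous_subtype_val.comp continuous_fst)
    · simp only [h, dite_false]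
      fun_prop

theorem compactifiable_of_containsCopy_cantor (F : Set (Compacts CantorSpace)) (hF : AnalyticSet F)
    (h : ContainsCopy F CantorSpace) : Compactifiable (spacesOf F) := by
  refine compactifiable_of_hasCopyNhds hF fun K hK => hasCopyNhds_of_nonempty hK fun hne => ?_
  intro U hU hKU
  let r : ∀ n, CantorSpace → Fin n → Bool := fun n x i => x i
  have hr : ∀ n, Continuous (r n) := fun n => by fun_prop
  have hcl : ∀ n (S : Set (Fin n → Bool)), IsClopen (r n ⁻¹' S) := fun n S =>
    (isClopen_discrete S).preimage (hr n)
  -- The points whose cylinder of length `n` lies in `U` form an open set increasing with `n`, so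
  -- one `n` serves all of `K`.
  obtain ⟨n, hn⟩ := K.isCompact.elim_directed_cover
    (fun n => r n ⁻¹' {s | r n ⁻¹' {s} ⊆ U}) (fun n => (hcl n _).isOpen)
    (fun x hx => by
      obtain ⟨_, ⟨y, n, rfl⟩, hxy, hyU⟩ :=
        (PiNat.isTopologicalBasis_cylinders fun _ : ℕ => Bool).mem_nhds_iff.1
          (hU.mem_nhds (hKU hx))
      refine mem_iUnion.2 ⟨n, fun z hz => hyU fun i hi => ?_⟩
      rw [← hxy i hi]
      exact congrFun hz ⟨i, hi⟩)
    (directed_of_isDirected_le fun m n hmn x hx z hz => hx (by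
      funext i
      exact congrFun hz ⟨i, i.2.trans_le hmn⟩))
  have hKP : (K : Set CantorSpace) ⊆ r n ⁻¹' (r n '' K) := subset_preimage_image _ _
  refine ⟨r n ⁻¹' (r n '' K), (hcl n _).isClosed, ?_, ?_, ?_⟩
  · rwa [(hcl n _).isOpen.interior_eq]
  · rintro x ⟨y, hy, hxy⟩
    exact hn hy hxy.symm
  · obtain ⟨L, hL, ⟨e⟩⟩ := h
    have : Nonempty (r n '' (K : Set CantorSpace)) := (hne.image _).to_subtype
    obtain ⟨e'⟩ := nonempty_prod_homeomorph_cantor (r n '' (K : Set CantorSpace))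
    exact ⟨L, hL, ⟨e.trans (e'.symm.trans (prefixSetHomeomorph n _).symm)⟩⟩

end Cantor

/-! ### Closedness of the space of continua -/

section Continua

open Topology

/-- A separation of `K` extends to disjoint open sets `U` and `V`. Being contained in their union
and meeting both is an open condition in the Vietoris topology. -/
theorem isClosed_continua (X : Type u) [TopologicalSpace X] [T2Space X] :
    IsClosed (continua X) := by
  rw [← isOpen_compl_iff, isOpen_iff_mem_nhds]
  intro K hK
  simp only [continua, mem_compl_iff, mem_ofPred_eq, isPreconnected_closed_iff] at hK
  push Not at hK
  obtain ⟨s, t, hs, ht, hst, hKs, hKt, hd⟩ := hK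
  obtain ⟨U, V, hU, hV, hsU, htV, hUV⟩ := SeparatedNhds.of_isCompact_isCompact
    (K.isCompact.inter_right hs) (K.isCompact.inter_right ht) (by
      rw [disjoint_iff_inter_eq_empty, ← hd, inter_inter_inter_comm, inter_self])
  have hKUV : (K : Set X) ⊆ U ∪ V := fun x hx =>
    (hst hx).imp (fun h => hsU ⟨hx, h⟩) (fun h => htV ⟨hx, h⟩)
  filter_upwards [(Compacts.isOpen_subsets_of_isOpen (hU.union hV)).mem_nhds hKUV,
    (Compacts.isOpen_inter_nonempty_of_isOpen hU).mem_nhds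
      (show ((K : Set X) ∩ U).Nonempty from hKs.mono fun x hx => ⟨hx.1, hsU hx⟩),
    (Compacts.isOpen_inter_nonempty_of_isOpen hV).mem_nhds
      (show ((K : Set X) ∩ V).Nonempty from hKt.mono fun x hx => ⟨hx.1, htV hx⟩)]
    with L hL hLU hLV hLc
  obtain ⟨x, -, hxU, hxV⟩ := hLc U V hU hV hL hLU hLV
  exact hUV.ne_of_mem hxU hxV rfl

end Continua

/-! ### Peano neighborhoods of continua -/

section Peano

open Topology

variable {X : Type u} [TopologicalSpace X]

/-- If all points have arbitrarily small neighborhoods that are continuous images of a connected and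
locally connected compactum, then so do all continua, with Peano continua as neighborhoods. -/
theorem exists_isPeanoContinuum_nhd [CompactSpace X] [MetrizableSpace X] {C : Type*}
    [TopologicalSpace C] [CompactSpace C] [ConnectedSpace C] [LocallyConnectedSpace C]
    (hC : ∀ x : X, ∀ U ∈ 𝓝 x, ∃ g : C → X, Continuous g ∧ range g ∈ 𝓝 x ∧ range g ⊆ U)
    {K : Set X} (hK : IsCompact K) (hKc : IsPreconnected K) (hKne : K.Nonempty) {U : Set X}
    (hU : IsOpen U) (hKU : K ⊆ U) :
    ∃ P : Set X, IsClosed P ∧ K ⊆ interior P ∧ P ⊆ U ∧ IsPeanoContinuum P := by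
  have : Nonempty X := ⟨hKne.some⟩
  choose! g hg hgx hgU using fun x (hx : x ∈ K) => hC x U (hU.mem_nhds (hKU hx))
  obtain ⟨t, htK, hKt⟩ := hK.elim_nhds_subcover (fun x => interior (range (g x)))
    fun x hx => interior_mem_nhds.2 (hgx x hx)
  let h : t × C → X := fun z => g z.1 z.2
  have hh : Continuous h := continuous_prod_of_discrete_left.2 fun x => hg x (htK _ x.2)
  have hrange : range h = ⋃ x ∈ t, range (g x) := by
    ext y
    simp [h]
  have hKP : K ⊆ interior (range h) := by
    rw [hrange]
    refine hKt.trans (iUnion₂_subset fun x hx => interior_mono ?_)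
    exact subset_biUnion_of_mem (u := fun x => range (g x)) hx
  have hcpt : IsCompact (range h) := isCompact_range hh
  refine ⟨range h, hcpt.isClosed, hKP, ?_, isCompact_iff_compactSpace.1 hcpt, inferInstance, ?_,
    ?_⟩
  · rw [hrange]
    exact iUnion₂_subset fun x hx => hgU x (htK x hx)
  · rw [← isConnected_iff_connectedSpace]
    refine ⟨hKne.mono (hKP.trans interior_subset), ?_⟩
    obtain ⟨x₀, hx₀⟩ := hKne
    -- Adding `K` to each piece changes nothing in the union and makes all the connected pieces
    -- share a point.
    have : range h = ⋃ x : t, (K ∪ range (g x)) := by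
      refine Subset.antisymm ?_ (iUnion_subset fun x => union_subset
        (hKP.trans interior_subset) ?_)
      · rintro _ ⟨⟨x, c⟩, rfl⟩
        exact mem_iUnion.2 ⟨x, Or.inr ⟨c, rfl⟩⟩
      · rintro _ ⟨c, rfl⟩
        exact ⟨(x, c), rfl⟩
    rw [this]
    refine isPreconnected_iUnion ⟨x₀, mem_iInter.2 fun x => Or.inl hx₀⟩ fun x => ?_
    exact hKc.union x.1 (htK _ x.2) (mem_of_mem_nhds (hgx x (htK _ x.2)))
      (isPreconnected_range (hg x (htK _ x.2)))
  · have : CompactSpace (range h) := isCompact_iff_compactSpace.1 hcpt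
    -- A continuous surjection from a compact onto a Hausdorff space is a quotient map, and
    -- quotients preserve local connectedness.
    exact (IsQuotientMap.of_surjective_continuous (rangeFactorization_surjective (f := h))
      hh.rangeFactorization).isCoinducing.locallyConnectedSpace

instance : LocallyConnectedSpace unitInterval :=
  locallyConnectedSpace_iff_connected_subsets.2 fun _ _ hU => by
    obtain ⟨b, c, -, h, hs⟩ := exists_Icc_mem_subset_of_mem_nhds hU
    exact ⟨_, h, isPreconnected_Icc, hs⟩

/-- Clamping finitely many coordinates retracts the cube onto a closed box around `x`. -/
theorem HilbertCube.exists_range_nhd (x : HilbertCube) (U : Set HilbertCube) (hU : U ∈ 𝓝 x) :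
    ∃ g : HilbertCube → HilbertCube, Continuous g ∧ range g ∈ 𝓝 x ∧ range g ⊆ U := by
  classical
  rw [nhds_pi, Filter.mem_pi] at hU
  obtain ⟨I, hI, t, ht, htU⟩ := hU
  choose l u hlu hn hs using fun i => exists_Icc_mem_subset_of_mem_nhds (ht i)
  let g : HilbertCube → HilbertCube := fun y i => if i ∈ I then max (l i) (min (u i) (y i)) else y i
  have hg : Continuous g := by
    refine continuous_pi fun i => ?_
    by_cases hi : i ∈ I
    · simp only [g, hi, if_true]
      fun_prop
    · simp only [g, hi, if_false]
      fun_prop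
  have hle : ∀ i, l i ≤ u i := fun i => (hlu i).1.trans (hlu i).2
  refine ⟨g, hg, ?_, ?_⟩
  · refine Filter.mem_of_superset (set_pi_mem_nhds hI fun i _ => hn i) fun y hy => ⟨y, ?_⟩
    funext i
    by_cases hi : i ∈ I
    · simp [g, hi, (hy i hi).1, (hy i hi).2]
    · simp [g, hi]
  · rintro _ ⟨y, rfl⟩
    refine htU fun i hi => hs i ?_
    simp only [g, hi, if_true]
    exact ⟨le_max_left _ _, max_le (hle i) (min_le_left _ _)⟩

/-- An analytic family of continua in the Hilbert cube that
contains copies of all Peano continua is compactifiable. -/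
theorem compactifiable_of_containsCopy_peano (F : Set (Compacts HilbertCube)) (hF : AnalyticSet F)
    (hFc : F ⊆ continua HilbertCube)
    (h : ∀ (Y : Type) [TopologicalSpace Y], IsPeanoContinuum Y → ContainsCopy F Y) :
    Compactifiable (spacesOf F) := by
  refine compactifiable_of_hasCopyNhds hF fun K hK => hasCopyNhds_of_nonempty hK fun hne => ?_
  intro U hU hKU
  obtain ⟨P, hP, hKP, hPU, hPP⟩ := exists_isPeanoContinuum_nhd HilbertCube.exists_range_nhd
    K.isCompact (closure_minimal hFc (isClosed_continua _) hK) hne hU hKU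
  exact ⟨P, hP, hKP, hPU, h P hPP⟩

end Peano

/-! ### Property S and analyticity of the family of Peano continua -/

section PropertyS

open Topology

variable {X : Type u} [MetricSpace X]

/-- The compact sets that are unions of finitely many continua of diameter at most `ε`. -/
def finiteUnionsOfSmallContinua (X : Type u) [MetricSpace X] (ε : ℝ) : Set (Compacts X) :=
  ⋃ m : ℕ, (fun c : Fin m → Compacts X => Finset.univ.sup c) ''
    univ.pi fun _ => continua X ∩ {K | (K : Set X) ×ˢ (K : Set X) ⊆ {z | dist z.1 z.2 ≤ ε}}

/-- Small continua form a compact family, and finite unions depend continuously on their terms, so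
the family is a countable union of compact sets. -/
theorem analyticSet_finiteUnionsOfSmallContinua [CompactSpace X] (ε : ℝ) :
    AnalyticSet (finiteUnionsOfSmallContinua X ε) := by
  have hsmall : IsClosed {K : Compacts X |
      (K : Set X) ×ˢ (K : Set X) ⊆ {z | dist z.1 z.2 ≤ ε}} :=
    (Compacts.isClosed_subsets_of_isClosed
      (isClosed_le (f := fun z : X × X => dist z.1 z.2) (by fun_prop) continuous_const)).preimage
      (Compacts.continuous_prod.comp (continuous_id.prodMk continuous_id))
  refine AnalyticSet.iUnion fun m => IsClosed.analyticSet (IsCompact.isClosed ?_)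
  exact (isClosed_set_pi fun _ _ => (isClosed_continua X).inter hsmall).isCompact.image
    (Continuous.finset_sup_apply fun i _ => continuous_apply i)

theorem mem_finiteUnionsOfSmallContinua {ε : ℝ} {K : Compacts X} :
    K ∈ finiteUnionsOfSmallContinua X ε ↔ ∃ (m : ℕ) (c : Fin m → Compacts X),
      (∀ i, IsPreconnected (c i : Set X) ∧ ∀ x ∈ c i, ∀ y ∈ c i, dist x y ≤ ε) ∧
        (K : Set X) = ⋃ i, (c i : Set X) := by
  simp only [finiteUnionsOfSmallContinua, mem_iUnion, mem_image, mem_pi, mem_univ, true_imp_iff]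
  refine exists_congr fun m => exists_congr fun c => and_congr (forall_congr' fun i => ?_) ?_
  · refine and_congr Iff.rfl ⟨fun h x hx y hy => h (mk_mem_prod hx hy), fun h z hz =>
      h _ hz.1 _ hz.2⟩
  · rw [← SetLike.coe_set_eq, Compacts.coe_finset_sup, eq_comm]
    simp [Finset.sup_eq_iSup]

/-- A compact set is locally connected if it is a finite union of arbitrarily small continua. -/
theorem locallyConnectedSpace_of_finiteUnions {K : Compacts X}
    (h : ∀ n : ℕ, K ∈ finiteUnionsOfSmallContinua X (1 / ((n : ℝ) + 1))) :
    LocallyConnectedSpace K := by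
  rw [locallyConnectedSpace_iff_connected_subsets]
  intro x U hU
  obtain ⟨ε, hε, hεU⟩ := Metric.mem_nhds_iff.1 hU
  obtain ⟨n, hn⟩ := exists_nat_one_div_lt hε
  obtain ⟨m, c, hc, hKc⟩ := mem_finiteUnionsOfSmallContinua.1 (h n)
  have hcK : ∀ i, (c i : Set X) ⊆ K := fun i => hKc ▸ subset_iUnion (fun i => (c i : Set X)) i
  -- The pieces through `x` form a connected set. It is a neighborhood of `x` because the finitely
  -- many remaining pieces have a closed union missing `x`.
  let S : Set K := ⋃ i : {i // x.1 ∈ c i}, Subtype.val ⁻¹' (c i : Set X)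
  have hcl : IsClosed (⋃ i : {i // x.1 ∉ c i}, (Subtype.val ⁻¹' (c i : Set X) : Set K)) :=
    isClosed_iUnion_of_finite fun i =>
      (c i).isCompact.isClosed.preimage continuous_subtype_val
  refine ⟨S, Filter.mem_of_superset (hcl.isOpen_compl.mem_nhds ?_) ?_, ?_, ?_⟩
  · intro hx
    obtain ⟨⟨i, hi⟩, hxi⟩ := mem_iUnion.1 hx
    exact hi hxi
  · intro y hy
    obtain ⟨i, hi⟩ := mem_iUnion.1 (hKc ▸ y.2 : y.1 ∈ ⋃ i, (c i : Set X))
    by_cases hxi : x.1 ∈ c i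
    · exact mem_iUnion.2 ⟨⟨i, hxi⟩, hi⟩
    · exact absurd (mem_iUnion.2 ⟨⟨i, hxi⟩, hi⟩) hy
  · refine isPreconnected_iUnion ⟨x, mem_iInter.2 fun i => i.2⟩ fun i => ?_
    have him : (Subtype.val : K → X) '' (Subtype.val ⁻¹' (c i : Set X)) = c i :=
      image_preimage_eq_of_subset fun y hy => ⟨⟨y, hcK i hy⟩, rfl⟩
    exact IsInducing.subtypeVal.isPreconnected_image.1 ((congrArg IsPreconnected him).mpr (hc i).1)
  · refine subset_trans (fun y hy => ?_) hεU
    obtain ⟨i, hi⟩ := mem_iUnion.1 hy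
    exact ((hc i).2 _ hi _ i.2).trans_lt hn

/-- Finitely many connected neighborhoods of radius at most `ε / 2` cover `K`; passing to closures
makes them compact and keeps them connected and of diameter at most `ε`. -/
theorem mem_finiteUnionsOfSmallContinua_of_locallyConnectedSpace {K : Compacts X}
    [LocallyConnectedSpace K] {ε : ℝ} (hε : 0 < ε) : K ∈ finiteUnionsOfSmallContinua X ε := by
  have : CompactSpace K := isCompact_iff_compactSpace.1 K.isCompact
  have hloc : ∀ x : K, ∃ V ∈ 𝓝 x, IsPreconnected V ∧ V ⊆ Metric.ball x (ε / 2) := fun x =>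
    locallyConnectedSpace_iff_connected_subsets.1 inferInstance x _
      (Metric.ball_mem_nhds x (by positivity))
  choose V hVn hVc hVb using hloc
  obtain ⟨t, -, ht⟩ := isCompact_univ.elim_nhds_subcover V fun x _ => hVn x
  let e := t.equivFin
  let c : K → Compacts X := fun x => ⟨Subtype.val '' closure (V x),
    (isClosed_closure.isCompact).image continuous_subtype_val⟩
  refine mem_finiteUnionsOfSmallContinua.2 ⟨t.card, fun i => c (e.symm i), fun i => ⟨?_, ?_⟩, ?_⟩
  · exact (hVc _).closure.image _ continuous_subtype_val.continuousOn
  · rintro _ ⟨y, hy, rfl⟩ _ ⟨z, hz, rfl⟩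
    have hb : ∀ w ∈ closure (V (e.symm i)), dist w (e.symm i : K) ≤ ε / 2 := fun w hw =>
      Metric.closure_ball_subset_closedBall (closure_mono (hVb _) hw)
    have h1 := dist_triangle_right y z (e.symm i : K)
    have h2 := hb y hy
    have h3 := hb z hz
    change dist y z ≤ ε
    linarith
  · ext y
    refine ⟨fun hy => ?_, fun hy => ?_⟩
    · obtain ⟨x, hx, hyx⟩ := mem_iUnion₂.1 (ht (mem_univ (⟨y, hy⟩ : K)))
      exact mem_iUnion.2 ⟨e ⟨x, hx⟩, ⟨y, hy⟩, by simpa using subset_closure hyx, rfl⟩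
    · obtain ⟨i, z, -, rfl⟩ := mem_iUnion.1 hy
      exact z.2

/-- By property S, local connectedness of a compactum is a countable conjunction of analytic
conditions; connectedness and nonemptiness are closed ones, as the empty set is isolated. -/
theorem analyticSet_isPeanoContinuum (X : Type u) [TopologicalSpace X] [CompactSpace X]
    [MetrizableSpace X] : AnalyticSet {K : Compacts X | IsPeanoContinuum K} := by
  let _ := metrizableSpaceMetric X
  have heq : {K : Compacts X | IsPeanoContinuum K} =
      ((⋂ n : ℕ, finiteUnionsOfSmallContinua X (1 / ((n : ℝ) + 1))) ∩ continua X) ∩ {⊥}ᶜ := by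
    ext K
    have hne : K ∈ ({⊥}ᶜ : Set (Compacts X)) ↔ (K : Set X).Nonempty := by
      rw [mem_compl_iff, mem_singleton_iff, ← SetLike.coe_set_eq, Compacts.coe_bot,
        nonempty_iff_ne_empty]
    refine ⟨fun ⟨_, _, h1, h2⟩ => ?_, fun ⟨⟨h1, h2⟩, h3⟩ => ?_⟩
    · have hcon : IsConnected (K : Set X) := isConnected_iff_connectedSpace.2 h1
      exact ⟨⟨mem_iInter.2 fun n =>
        mem_finiteUnionsOfSmallContinua_of_locallyConnectedSpace (by positivity),
        hcon.isPreconnected⟩, hne.2 hcon.nonempty⟩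
    · exact ⟨isCompact_iff_compactSpace.1 K.isCompact, inferInstance,
        isConnected_iff_connectedSpace.1 ⟨hne.1 h3, h2⟩,
        locallyConnectedSpace_of_finiteUnions (mem_iInter.1 h1)⟩
  have hcl : IsClosed (continua X ∩ {⊥}ᶜ) :=
    (isClosed_continua X).inter Compacts.isClopen_singleton_bot.compl.isClosed
  rw [heq, inter_assoc, inter_eq_iInter]
  refine AnalyticSet.iInter fun b => ?_
  cases b
  · exact hcl.analyticSet
  · exact AnalyticSet.iInter fun n => analyticSet_finiteUnionsOfSmallContinua _

end PropertyS

/-! ### All Peano continua, in any universe -/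

section Universe

theorem IsPeanoContinuum.of_homeomorph {Y : Type u} {Z : Type v} [TopologicalSpace Y]
    [TopologicalSpace Z] (h : IsPeanoContinuum Y) (e : Y ≃ₜ Z) : IsPeanoContinuum Z := by
  obtain ⟨_, _, _, _⟩ := h
  exact ⟨e.compactSpace, e.symm.isEmbedding.metrizableSpace,
    e.surjective.connectedSpace e.continuous, e.symm.locallyConnectedSpace⟩

theorem IsPeanoContinuum.exists_compacts_homeomorph {Y : Type u} [TopologicalSpace Y]
    (h : IsPeanoContinuum Y) : ∃ K : Compacts HilbertCube, Nonempty (K ≃ₜ Y) := by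
  obtain ⟨_, _, _, _⟩ := h
  let _ := metrizableSpaceMetric Y
  obtain ⟨f, hf⟩ := Metric.PiNatEmbed.exists_embedding_to_hilbert_cube (X := Y)
  exact ⟨⟨range f, isCompact_range hf.continuous⟩, ⟨hf.toHomeomorph.symm⟩⟩

theorem IsPeanoContinuum.containsCopy {Y : Type u} [TopologicalSpace Y]
    (h : IsPeanoContinuum Y) :
    ContainsCopy {K : Compacts HilbertCube | IsPeanoContinuum K} Y := by
  obtain ⟨K, ⟨e⟩⟩ := h.exists_compacts_homeomorph
  exact ⟨K, h.of_homeomorph e.symm, ⟨e⟩⟩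

/-- Compactifiability does not depend on the universe in which a class lives. -/
theorem Compactifiable.of_classEquiv {C : Set TopCat.{0}} {D : Set TopCat.{v}}
    (hC : Compactifiable C) (h : ClassEquiv C D) : Compactifiable D := by
  obtain ⟨A, B, _, _, _, _, _, _, q, hq, h1, h2⟩ := hC
  have := MetrizableSpace.ulift.{0, v} A
  have := MetrizableSpace.ulift.{0, v} B
  let q' : ULift.{v} A → ULift.{v} B := fun a => ULift.up (q a.down)
  have hq' : Continuous q' := by fun_prop
  have e : ∀ b : B, (q' ⁻¹' {ULift.up b}) ≃ₜ (q ⁻¹' {b}) := fun b =>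
    (Homeomorph.ulift (X := A)).subtype fun x => by
      change ULift.up (q x.down) = ULift.up b ↔ q x.down = b
      simp
  refine ⟨ULift.{v} A, ULift.{v} B, inferInstance, inferInstance, inferInstance, inferInstance,
    inferInstance, inferInstance, q', hq', ?_, ?_⟩
  · rintro _ ⟨⟨b⟩, rfl⟩
    obtain ⟨Y, hY, ⟨f⟩⟩ := h1 _ ⟨b, rfl⟩
    obtain ⟨Z, hZ, ⟨g⟩⟩ := h.1 Y hY
    exact ⟨Z, hZ, ⟨(e b).trans (f.trans g)⟩⟩
  · intro Z hZ
    obtain ⟨Y, hY, ⟨g⟩⟩ := h.2 Z hZ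
    obtain ⟨_, ⟨b, rfl⟩, ⟨f⟩⟩ := h2 Y hY
    exact ⟨_, ⟨ULift.up b, rfl⟩, ⟨(e b).trans (f.trans g)⟩⟩

theorem compactifiable_isPeanoContinuum :
    Compactifiable {Y : TopCat.{v} | IsPeanoContinuum Y} := by
  refine Compactifiable.of_classEquiv (compactifiable_of_containsCopy_peano _
    (analyticSet_isPeanoContinuum HilbertCube) (fun K hK => ?_)
    fun Y _ hY => hY.containsCopy) ⟨?_, ?_⟩
  · have := hK.2.2.1
    exact (isConnected_iff_connectedSpace.2 this).isPreconnected
  · rintro _ ⟨K, hK, rfl⟩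
    exact ⟨TopCat.of (ULift.{v} K), IsPeanoContinuum.of_homeomorph hK Homeomorph.ulift.symm,
      ⟨Homeomorph.ulift.symm⟩⟩
  · intro Y hY
    obtain ⟨K, hK, he⟩ := IsPeanoContinuum.containsCopy hY
    exact ⟨_, ⟨K, hK, rfl⟩, he⟩

end Universe

/-! ### Paths in the dendrite and the coordinatewise description of subcontinua -/

section Dendrite

open Topology

/-- The words that index the arcs of Ważewski's dendrite. -/
abbrev DendriteWord : Type := List (InnerRat × ℕ)

theorem List.exists_cons_isSuffix_of_isSuffix {α : Type*} {l m : List α} (h : l <:+ m)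
    (hne : l ≠ m) : ∃ z, z :: l <:+ m := by
  obtain ⟨t, rfl⟩ := h
  rcases t.eq_nil_or_concat with rfl | ⟨t', z, rfl⟩
  · exact absurd rfl hne
  · exact ⟨z, t', by simp⟩

variable {x y : DendriteWord → unitInterval} {a b c : DendriteWord}

theorem isClosed_wazewskiDendrite : IsClosed wazewskiDendrite := by
  simp only [wazewskiDendrite, ofPred_forall]
  refine isClosed_iInter fun a => isClosed_iInter fun r => isClosed_iInter fun n => ?_
  have h1 : IsOpen {x : DendriteWord → unitInterval | x ((r, n) :: a) ≠ 0} :=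
    isOpen_ne.preimage (continuous_apply _)
  have h2 : IsClosed {x : DendriteWord → unitInterval |
      (x a : ℝ) = ((r : ℚ) : ℝ) ∧ ∀ m : ℕ, m ≠ n → x ((r, m) :: a) = 0} := by
    refine (isClosed_eq (by fun_prop) continuous_const).and ?_
    simp only [ofPred_forall]
    exact isClosed_iInter fun m => isClosed_iInter fun _ =>
      isClosed_eq (continuous_apply _) continuous_const
  convert h1.isClosed_compl.union h2 using 1
  ext x
  exact imp_iff_not_or

instance : CompactSpace wazewskiDendrite :=
  isCompact_iff_compactSpace.1 isClosed_wazewskiDendrite.isCompact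

theorem innerRat_ne_zero (r : InnerRat) : ((r : ℚ) : ℝ) ≠ 0 := by
  exact_mod_cast r.2.1.ne'

theorem innerRat_cast_inj {r s : InnerRat} : ((r : ℚ) : ℝ) = ((s : ℚ) : ℝ) ↔ r = s := by
  rw [Rat.cast_inj, Subtype.ext_iff]

theorem ne_zero_of_cons_ne_zero (hx : x ∈ wazewskiDendrite) {z : InnerRat × ℕ}
    (h : x (z :: a) ≠ 0) : x a ≠ 0 := fun h0 => by
  have := (hx a z.1 z.2 h).1
  rw [h0] at this
  exact innerRat_ne_zero z.1 this.symm

theorem ne_zero_of_isSuffix (hx : x ∈ wazewskiDendrite) (h : a <:+ b) (hb : x b ≠ 0) :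
    x a ≠ 0 := by
  obtain ⟨t, rfl⟩ := h
  induction t with
  | nil => exact hb
  | cons z t ih => exact ih (ne_zero_of_cons_ne_zero hx hb)

/-- The value at an arc is determined by any arc that is entered later. -/
theorem eq_of_cons_isSuffix (hx : x ∈ wazewskiDendrite) {z : InnerRat × ℕ}
    (h : z :: a <:+ b) (hb : x b ≠ 0) : (x a : ℝ) = ((z.1 : ℚ) : ℝ) :=
  (hx a z.1 z.2 (ne_zero_of_isSuffix hx h hb)).1

/-- Both paths enter `b`, so both leave `a` at the rational parameter prescribed by the word `b`. -/
theorem eq_of_isSuffix (hx : x ∈ wazewskiDendrite) (hy : y ∈ wazewskiDendrite) (h : a <:+ b)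
    (hne : a ≠ b) (hxb : x b ≠ 0) (hyb : y b ≠ 0) : x a = y a := by
  obtain ⟨z, hz⟩ := List.exists_cons_isSuffix_of_isSuffix h hne
  exact Subtype.ext ((eq_of_cons_isSuffix hx hz hxb).trans (eq_of_cons_isSuffix hy hz hyb).symm)

/-- The arcs that are entered on the way to a point form a chain. -/
theorem isSuffix_or_isSuffix (hx : x ∈ wazewskiDendrite) (ha : x a ≠ 0) (hb : x b ≠ 0) :
    a <:+ b ∨ b <:+ a := by
  induction b with
  | nil => exact Or.inr (List.nil_suffix)
  | cons z b ih =>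
    rcases ih (ne_zero_of_cons_ne_zero hx hb) with h | h
    · exact Or.inl (h.trans (List.suffix_cons z b))
    · by_cases hab : b = a
      · exact Or.inl (hab ▸ List.suffix_cons z b)
      · obtain ⟨⟨s, m⟩, hw⟩ := List.exists_cons_isSuffix_of_isSuffix h hab
        obtain ⟨r, n⟩ := z
        have h1 := hx b r n hb
        have hwx := ne_zero_of_isSuffix hx hw ha
        obtain rfl : r = s := innerRat_cast_inj.1 (h1.1.symm.trans (hx b s m hwx).1)
        have hmn : m = n := by
          by_contra hne
          exact hwx (h1.2 m hne)
        exact Or.inr (hmn ▸ hw)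

/-- A point whose path ends in the arc `b` is determined by its parameter there. -/
theorem eq_of_eq_of_forall_cons_eq_zero (hx : x ∈ wazewskiDendrite) (hy : y ∈ wazewskiDendrite)
    (hb : b = [] ∨ x b ≠ 0) (hxy : y b = x b) (hx0 : ∀ z, x (z :: b) = 0)
    (hy0 : ∀ z, y (z :: b) = 0) : y = x := by
  have key : ∀ {w : DendriteWord → unitInterval}, w ∈ wazewskiDendrite → (b = [] ∨ w b ≠ 0) →
      (∀ z, w (z :: b) = 0) → ∀ {c}, w c ≠ 0 → c <:+ b := by
    intro w hw hwb hw0 c hc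
    have hcb : b <:+ c ∨ c <:+ b := by
      rcases hwb with rfl | hwb
      · exact Or.inl List.nil_suffix
      · exact isSuffix_or_isSuffix hw hwb hc
    rcases hcb with h | h
    · by_cases hbc : b = c
      · exact hbc ▸ List.suffix_rfl
      · obtain ⟨z, hz⟩ := List.exists_cons_isSuffix_of_isSuffix h hbc
        exact absurd (hw0 z) (ne_zero_of_isSuffix hw hz hc)
    · exact h
  have hyb : b = [] ∨ y b ≠ 0 := hxy ▸ hb
  funext c
  by_cases hcb : c <:+ b
  · by_cases hne : c = b
    · rw [hne, hxy]
    · have hb' : b ≠ [] := by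
        rintro rfl
        exact hne (List.suffix_nil.1 hcb)
      exact eq_of_isSuffix hy hx hcb hne (hyb.resolve_left hb') (hb.resolve_left hb')
  · rw [not_imp_comm.1 (key hx hb hx0) hcb, not_imp_comm.1 (key hy hyb hy0) hcb]

/-- A subcontinuum of the dendrite is the intersection of the dendrite with a box. -/
theorem mem_of_forall_exists_apply_eq {K : Set wazewskiDendrite} (hK : IsClosed K)
    (hKc : IsPreconnected K) (x : wazewskiDendrite) (h : ∀ b, ∃ y ∈ K, y.1 b = x.1 b) : x ∈ K := by
  -- If the path to `x` is infinite, points of `K` agreeing with `x` on deeper and deeper arcs of it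
  -- converge to `x`.
  by_cases hlen : ∀ k : ℕ, ∃ b : DendriteWord, b.length = k ∧ (b = [] ∨ x.1 b ≠ 0)
  · choose b hbl hb using hlen
    choose y hyK hy using fun k => h (b (k + 1))
    have hxb : ∀ k, x.1 (b (k + 1)) ≠ 0 := fun k => (hb (k + 1)).resolve_left fun h0 => by
      have := hbl (k + 1)
      rw [h0] at this
      simp at this
    have hlim : Filter.Tendsto y Filter.atTop (𝓝 x) := by
      rw [tendsto_subtype_rng, tendsto_pi_nhds]
      intro c
      refine tendsto_const_nhds.congr' ?_
      filter_upwards [Filter.eventually_ge_atTop c.length] with k hk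
      have hlt : c.length < (b (k + 1)).length := by
        rw [hbl]
        omega
      have hyb : (y k).1 (b (k + 1)) ≠ 0 := by
        rw [hy]
        exact hxb k
      have hnot : ¬b (k + 1) <:+ c := fun hs => absurd hs.length_le (by omega)
      by_cases hc : c <:+ b (k + 1)
      · exact eq_of_isSuffix x.2 (y k).2 hc (fun h0 => by rw [← h0] at hlt; omega) (hxb k) hyb
      · have hz : ∀ w : wazewskiDendrite, w.1 (b (k + 1)) ≠ 0 → w.1 c = 0 := fun w hw => by
          by_contra hwc
          exact (isSuffix_or_isSuffix w.2 hw hwc).elim hnot hc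
        rw [hz x (hxb k), hz (y k) hyb]
    exact hK.mem_of_tendsto hlim (Filter.Eventually.of_forall hyK)
  · obtain ⟨b, hb, hb0⟩ : ∃ b : DendriteWord, (b = [] ∨ x.1 b ≠ 0) ∧ ∀ z, x.1 (z :: b) = 0 := by
      by_contra! hcon
      refine hlen fun k => ?_
      induction k with
      | zero => exact ⟨[], rfl, Or.inl rfl⟩
      | succ k ih =>
        obtain ⟨b, hbl, hb⟩ := ih
        obtain ⟨z, hz⟩ := hcon b hb
        exact ⟨z :: b, by simp [hbl], Or.inr hz⟩
    by_contra hxK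
    -- The path to `x` ends in the arc `b`. If `x` is not in `K`, any point of `K` with the same
    -- parameter at `b` must turn off there. One such branch is then split off from the rest of `K`
    -- by the open sets `V` and `W`.
    have hne : ∀ y ∈ K, y.1 b = x.1 b → ∃ z, y.1 (z :: b) ≠ 0 := by
      intro y hy hyb
      by_contra! hy0
      have := eq_of_eq_of_forall_cons_eq_zero x.2 y.2 hb hyb hb0 hy0
      exact hxK (Subtype.ext this ▸ hy)
    obtain ⟨y₀, hy₀, hy₀b⟩ := h b
    obtain ⟨⟨r, n⟩, hrn⟩ := hne y₀ hy₀ hy₀b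
    have hxr : (x.1 b : ℝ) = ((r : ℚ) : ℝ) := by
      rw [← hy₀b]
      exact (y₀.2 b r n hrn).1
    obtain ⟨y₁, hy₁, hy₁b⟩ := h ((r, n) :: b)
    have hcont : ∀ c : DendriteWord, Continuous fun y : wazewskiDendrite => y.1 c := fun c =>
      (continuous_apply c).comp continuous_subtype_val
    let V : Set wazewskiDendrite := {y | y.1 ((r, n) :: b) ≠ 0}
    let W : Set wazewskiDendrite := {y | y.1 b ≠ x.1 b} ∪ ⋃ m : {m // m ≠ n},
      {y | y.1 ((r, m.1) :: b) ≠ 0}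
    have hV : IsOpen V := isOpen_ne.preimage (hcont _)
    have hW : IsOpen W := (isOpen_ne.preimage (hcont _)).union
      (isOpen_iUnion fun m => isOpen_ne.preimage (hcont _))
    have hmemW : ∀ y ∈ K, y ∉ V → y ∈ W := by
      intro y hy hyV
      by_cases hyb : y.1 b = x.1 b
      · obtain ⟨⟨s, m⟩, hsm⟩ := hne y hy hyb
        obtain rfl : s = r := innerRat_cast_inj.1 (by
          rw [← hxr, ← hyb]
          exact (y.2 b s m hsm).1.symm)
        refine Or.inr (mem_iUnion.2 ⟨⟨m, ?_⟩, hsm⟩)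
        rintro rfl
        exact hyV hsm
      · exact Or.inl hyb
    obtain ⟨y, -, hyV, hyW⟩ := hKc V W hV hW
      (fun y hy => or_iff_not_imp_left.2 (hmemW y hy)) ⟨y₀, hy₀, hrn⟩
      ⟨y₁, hy₁, hmemW y₁ hy₁ fun h1 => h1 (hy₁b.trans (hb0 _))⟩
    have hyD := y.2 b r n hyV
    rcases hyW with hyW | hyW
    · exact hyW (Subtype.ext (hyD.1.trans hxr.symm))
    · obtain ⟨m, hm⟩ := mem_iUnion.1 hyW
      exact hm (hyD.2 m.1 m.2)

end Dendrite

/-! ### Cut neighborhoods and their affine rescaling -/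

section Dendrite

open Topology

/-- The image of an inner rational under the increasing affine bijection of `[0, 1]` onto `[l, h]`,
for a nondegenerate subinterval `[l, h]` of `[0, 1]`. -/
def innerRatAffine (l h : ℚ) (r : InnerRat) : InnerRat :=
  -- The default value `r` is never used if `0 ≤ l < h ≤ 1`.
  if H : 0 < l + r.1 * (h - l) ∧ l + r.1 * (h - l) < 1 then ⟨_, H⟩ else r

theorem innerRatAffine_coe {l h : ℚ} (hl : 0 ≤ l) (hlh : l < h) (hh : h ≤ 1) (r : InnerRat) :
    (innerRatAffine l h r : ℚ) = l + r.1 * (h - l) := by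
  rw [innerRatAffine, dif_pos]
  have h1 := mul_pos r.2.1 (sub_pos.2 hlh)
  have h2 := mul_lt_mul_of_pos_right r.2.2 (sub_pos.2 hlh)
  constructor <;> linarith

/-- Data that cut a neighborhood out of Ważewski's dendrite: a lower bound for the parameter at the
arc `base`, and upper bounds for the parameters at all arcs. -/
structure DendriteCut where
  /-- The arc on which the neighborhood starts. -/
  base : DendriteWord
  /-- The parameter on `base` at which the neighborhood starts. -/
  low : ℚ
  /-- The parameters at which the arcs are cut. -/
  high : DendriteWord → ℚ
  low_nonneg : 0 ≤ low
  low_lt : low < high base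
  high_pos : ∀ b, 0 < high b
  high_le_one : ∀ b, high b ≤ 1
  -- A nonempty base has a positive lower bound, so every point of the neighborhood enters it and
  -- has its parameters on the way there prescribed.
  base_eq_nil : low = 0 → base = []

namespace DendriteCut

variable (C : DendriteCut)

/-- The lower bound for the parameter at the arc of the neighborhood with the index `w`. -/
def lo : DendriteWord → ℚ
  | [] => C.low
  | _ :: _ => 0

/-- The arc of the dendrite that contains the arc of the neighborhood with the index `w`. -/
def word : DendriteWord → DendriteWord
  | [] => C.base
  | z :: w => (innerRatAffine (C.lo w) (C.high (word w)) z.1, z.2) :: word w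

theorem lo_nonneg (w : DendriteWord) : 0 ≤ C.lo w := by
  cases w
  · exact C.low_nonneg
  · exact le_rfl

theorem lo_lt (w : DendriteWord) : C.lo w < C.high (C.word w) := by
  cases w
  · exact C.low_lt
  · exact C.high_pos _

theorem affine_coe (w : DendriteWord) (r : InnerRat) :
    (innerRatAffine (C.lo w) (C.high (C.word w)) r : ℚ) =
      C.lo w + r.1 * (C.high (C.word w) - C.lo w) :=
  innerRatAffine_coe (C.lo_nonneg w) (C.lo_lt w) (C.high_le_one _) r

theorem affine_injective (w : DendriteWord) :
    Function.Injective (innerRatAffine (C.lo w) (C.high (C.word w))) := by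
  intro r s h
  have h1 := C.affine_coe w r
  rw [h, C.affine_coe w s] at h1
  have h2 := mul_right_cancel₀ (sub_pos.2 (C.lo_lt w)).ne' (add_left_cancel h1)
  exact Subtype.ext h2.symm

theorem exists_affine_eq (w : DendriteWord) (s : InnerRat) (h1 : C.lo w < s.1)
    (h2 : s.1 < C.high (C.word w)) : ∃ r, innerRatAffine (C.lo w) (C.high (C.word w)) r = s := by
  have hpos := sub_pos.2 (C.lo_lt w)
  refine ⟨⟨(s.1 - C.lo w) / (C.high (C.word w) - C.lo w), div_pos (sub_pos.2 h1) hpos,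
    (div_lt_one hpos).2 (by linarith)⟩, Subtype.ext ?_⟩
  rw [C.affine_coe, div_mul_cancel₀ _ hpos.ne']
  ring

theorem length_word (w : DendriteWord) : (C.word w).length = w.length + C.base.length := by
  induction w with
  | nil => simp [word]
  | cons z w ih => simp [word, ih]; omega

theorem word_injective : Function.Injective C.word := by
  intro w
  induction w with
  | nil =>
    intro w' h
    have := congrArg List.length h
    rw [length_word, length_word] at this
    simp only [List.length_nil] at this
    exact (List.length_eq_zero_iff.1 (by omega)).symm
  | cons z w ih =>
    intro w' h
    cases w' with
    | nil =>
      have := congrArg List.length h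
      rw [length_word, length_word] at this
      simp only [List.length_nil, List.length_cons] at this
      omega
    | cons z' w' =>
      simp only [word, List.cons.injEq, Prod.mk.injEq] at h
      obtain rfl := ih h.2
      rw [Prod.ext (C.affine_injective w h.1.1) h.1.2]

/-- The neighborhood cut out by the data. At the ends of the cut arcs, the arcs that branch off
there are removed. -/
def nhd : Set wazewskiDendrite :=
  {x | (∀ w, (C.lo w : ℝ) ≤ x.1 (C.word w) ∧ (x.1 (C.word w) : ℝ) ≤ C.high (C.word w)) ∧
    ∀ b, ¬b <:+ C.base → b ∉ range C.word → x.1 b = 0}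

theorem isClosed_nhd : IsClosed C.nhd := by
  have hcont : ∀ c : DendriteWord, Continuous fun y : wazewskiDendrite => y.1 c := fun c =>
    (continuous_apply c).comp continuous_subtype_val
  have hcont' : ∀ c : DendriteWord, Continuous fun y : wazewskiDendrite => (y.1 c : ℝ) := fun c =>
    continuous_subtype_val.comp (hcont c)
  simp only [nhd, ofPred_and, ofPred_forall]
  refine (isClosed_iInter fun w => ?_).inter (isClosed_iInter fun b => isClosed_iInter fun _ =>
    isClosed_iInter fun _ => isClosed_eq (hcont b) continuous_const)
  exact (isClosed_le continuous_const (hcont' _)).inter (isClosed_le (hcont' _) continuous_const)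

variable {C}

theorem apply_base_ne_zero {x : wazewskiDendrite} (hx : (C.low : ℝ) ≤ x.1 C.base)
    (hb : C.base ≠ []) : x.1 C.base ≠ 0 := by
  intro h0
  rw [h0, Icc.coe_zero] at hx
  have : C.low ≤ 0 := by exact_mod_cast hx
  exact hb (C.base_eq_nil (le_antisymm this C.low_nonneg))

theorem low_le_apply {x : wazewskiDendrite} (hx : x ∈ C.nhd) : (C.low : ℝ) ≤ x.1 C.base :=
  (hx.1 []).1

/-- Points that satisfy the bounds strictly belong to the neighborhood. -/
theorem mem_nhd_of_lt {x : wazewskiDendrite} (hlow : C.low = 0 ∨ (C.low : ℝ) < x.1 C.base)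
    (hhigh : ∀ b, C.high b < 1 → (x.1 b : ℝ) < C.high b) : x ∈ C.nhd := by
  have hlow' : (C.low : ℝ) ≤ x.1 C.base := by
    rcases hlow with h | h
    · rw [h]
      simpa using (x.1 C.base).2.1
    · exact h.le
  refine ⟨fun w => ⟨?_, ?_⟩, ?_⟩
  · cases w with
    | nil => exact hlow'
    | cons z w => simpa [lo] using (x.1 (C.word (z :: w))).2.1
  · rcases (C.high_le_one (C.word w)).lt_or_eq with h | h
    · exact (hhigh _ h).le
    · rw [h]
      simpa using (x.1 (C.word w)).2.2
  · have key : ∀ b, C.base <:+ b → x.1 b ≠ 0 → b ∈ range C.word := by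
      intro b
      induction b with
      | nil =>
        intro h _
        exact ⟨[], List.suffix_nil.1 h⟩
      | cons z b ih =>
        intro h hxb
        rcases List.suffix_cons_iff.1 h with h | h
        · exact ⟨[], h⟩
        · obtain ⟨w, rfl⟩ := ih h (ne_zero_of_cons_ne_zero x.2 hxb)
          have hxr := (x.2 _ z.1 z.2 hxb).1
          have h1 : C.lo w < z.1.1 := by
            cases w with
            | nil =>
              rcases hlow with h0 | h0
              · rw [lo, h0]
                exact z.1.2.1
              · rw [word] at hxr
                rw [hxr] at h0
                exact_mod_cast h0
            | cons => exact z.1.2.1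
          have h2 : z.1.1 < C.high (C.word w) := by
            rcases (C.high_le_one (C.word w)).lt_or_eq with h | h
            · have := hhigh _ h
              rw [hxr] at this
              exact_mod_cast this
            · rw [h]
              exact z.1.2.2
          obtain ⟨r, hr⟩ := C.exists_affine_eq w z.1 h1 h2
          exact ⟨(r, z.2) :: w, by rw [word, hr]⟩
    intro b hb hbw
    by_contra hxb
    have hbase : C.base <:+ b := by
      by_cases h0 : C.base = []
      · rw [h0]
        exact List.nil_suffix
      · exact (isSuffix_or_isSuffix x.2 (apply_base_ne_zero hlow' h0) hxb).resolve_right hb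
    exact hbw (key b hbase hxb)

variable (C)

theorem width_pos (w : DendriteWord) : (0 : ℝ) < C.high (C.word w) - C.lo w :=
  sub_pos.2 (by exact_mod_cast C.lo_lt w)

/-- The affine change of all parameters that maps the neighborhood onto the whole dendrite. -/
noncomputable def toDendriteFun (x : C.nhd) (w : DendriteWord) : unitInterval :=
  ⟨((x.1.1 (C.word w) : ℝ) - C.lo w) / (C.high (C.word w) - C.lo w),
    div_nonneg (sub_nonneg.2 (x.2.1 w).1) (C.width_pos w).le,
    (div_le_one (C.width_pos w)).2 (sub_le_sub_right (x.2.1 w).2 _)⟩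

/-- All arcs except the first one start at `lo = 0`, so rescaling preserves which of them are
entered. -/
theorem toDendriteFun_cons_eq_zero_iff (x : C.nhd) (z : InnerRat × ℕ) (w : DendriteWord) :
    C.toDendriteFun x (z :: w) = 0 ↔ x.1.1 (C.word (z :: w)) = 0 := by
  have := C.width_pos (z :: w)
  rw [Subtype.ext_iff, Subtype.ext_iff]
  change _ / _ = (0 : ℝ) ↔ _ = (0 : ℝ)
  rw [div_eq_zero_iff, or_iff_left this.ne']
  simp [lo]

theorem toDendriteFun_mem (x : C.nhd) : C.toDendriteFun x ∈ wazewskiDendrite := by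
  intro w r n h
  rw [Ne, toDendriteFun_cons_eq_zero_iff] at h
  obtain ⟨h1, h2⟩ := x.1.2 _ _ _ h
  refine ⟨?_, fun m hm => ?_⟩
  · simp only [toDendriteFun]
    rw [h1, C.affine_coe, div_eq_iff (C.width_pos w).ne']
    push_cast
    ring
  · rw [toDendriteFun_cons_eq_zero_iff]
    exact h2 m hm

theorem toDendriteFun_injective : Function.Injective C.toDendriteFun := by
  intro x y h
  have hw : ∀ w, x.1.1 (C.word w) = y.1.1 (C.word w) := by
    intro w
    have := congrArg Subtype.val (congrFun h w)
    simp only [toDendriteFun] at this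
    rw [div_left_inj' (C.width_pos w).ne', sub_left_inj] at this
    exact Subtype.ext this
  refine Subtype.ext (Subtype.ext (funext fun b => ?_))
  by_cases hb : b ∈ range C.word
  · obtain ⟨w, rfl⟩ := hb
    exact hw w
  -- Parameters not indexed by `word` carry no information: they are prescribed on the path to
  -- `base` and vanish elsewhere.
  · by_cases hs : b <:+ C.base
    · have hne : b ≠ C.base := fun h0 => hb ⟨[], h0.symm⟩
      have h0 : C.base ≠ [] := fun h0 => hne (by
        rw [h0] at hs ⊢
        exact List.suffix_nil.1 hs)
      exact eq_of_isSuffix x.1.2 y.1.2 hs hne (apply_base_ne_zero (low_le_apply x.2) h0)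
        (apply_base_ne_zero (low_le_apply y.2) h0)
    · rw [x.2.2 b hs hb, y.2.2 b hs hb]

open Classical in
/-- The inverse of the change of parameters. -/
noncomputable def ofDendriteFun (y : DendriteWord → unitInterval) (b : DendriteWord) :
    unitInterval :=
  if h : ∃ w, C.word w = b then
    ⟨C.lo h.choose + y h.choose * (C.high (C.word h.choose) - C.lo h.choose),
      add_nonneg (by exact_mod_cast C.lo_nonneg _)
        (mul_nonneg (y _).2.1 (C.width_pos _).le), by
      have h1 := mul_le_mul_of_nonneg_right (y h.choose).2.2 (C.width_pos h.choose).le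
      have h2 : (C.high (C.word h.choose) : ℝ) ≤ 1 := by exact_mod_cast C.high_le_one _
      linarith⟩
  else if h : ∃ z : InnerRat × ℕ, z :: b <:+ C.base then
    ⟨((h.choose.1 : ℚ) : ℝ), by exact_mod_cast h.choose.1.2.1.le,
      by exact_mod_cast h.choose.1.2.2.le⟩
  else 0

theorem ofDendriteFun_word (y : DendriteWord → unitInterval) (w : DendriteWord) :
    (C.ofDendriteFun y (C.word w) : ℝ) = C.lo w + y w * (C.high (C.word w) - C.lo w) := by
  have h : ∃ w', C.word w' = C.word w := ⟨w, rfl⟩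
  have hw : h.choose = w := C.word_injective h.choose_spec
  rw [ofDendriteFun, dif_pos h]
  simp only [hw]

theorem not_mem_range_word_of_length_lt {b : DendriteWord} (h : b.length < C.base.length) :
    ¬∃ w, C.word w = b := by
  rintro ⟨w, rfl⟩
  rw [C.length_word] at h
  omega

theorem ofDendriteFun_of_isSuffix (y : DendriteWord → unitInterval) {b : DendriteWord}
    {z : InnerRat × ℕ} (hz : z :: b <:+ C.base) :
    (C.ofDendriteFun y b : ℝ) = ((z.1 : ℚ) : ℝ) := by
  have h : ∃ z : InnerRat × ℕ, z :: b <:+ C.base := ⟨z, hz⟩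
  have hlen : b.length < C.base.length := by
    have := hz.length_le
    simp only [List.length_cons] at this
    omega
  have heq : h.choose = z := by
    have := (List.suffix_of_suffix_length_le h.choose_spec hz (by simp)).eq_of_length (by simp)
    exact (List.cons.inj this).1
  rw [ofDendriteFun, dif_neg (C.not_mem_range_word_of_length_lt hlen), dif_pos h]
  simp only [heq]

theorem ofDendriteFun_of_not_isSuffix (y : DendriteWord → unitInterval) {b : DendriteWord}
    (hb : b ∉ range C.word) (hs : ¬b <:+ C.base) : C.ofDendriteFun y b = 0 := by
  rw [ofDendriteFun, dif_neg (show ¬∃ w, C.word w = b from hb), dif_neg]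
  rintro ⟨z, hz⟩
  exact hs ((List.suffix_cons z b).trans hz)

theorem ofDendriteFun_cons_eq_zero_iff (y : DendriteWord → unitInterval) (z : InnerRat × ℕ)
    (w : DendriteWord) : C.ofDendriteFun y (C.word (z :: w)) = 0 ↔ y (z :: w) = 0 := by
  have h := C.ofDendriteFun_word y (z :: w)
  have hpos := C.width_pos (z :: w)
  simp only [lo, Rat.cast_zero, zero_add, sub_zero] at h hpos
  rw [Subtype.ext_iff, h, Subtype.ext_iff]
  simp [hpos.ne']

theorem ofDendriteFun_mem {y : DendriteWord → unitInterval} (hy : y ∈ wazewskiDendrite) :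
    C.ofDendriteFun y ∈ wazewskiDendrite := by
  intro b r n h
  -- Turns on the path to `base`, the last one into `base` included, are fixed by the word `base`;
  -- siblings of its arcs are never entered.
  have hsuffix : (r, n) :: b <:+ C.base → (C.ofDendriteFun y b : ℝ) = ((r : ℚ) : ℝ) ∧
      ∀ m : ℕ, m ≠ n → C.ofDendriteFun y ((r, m) :: b) = 0 := by
    intro hs
    refine ⟨C.ofDendriteFun_of_isSuffix y hs, fun m hm => ?_⟩
    have hns : ¬(r, m) :: b <:+ C.base := fun hs' => by
      have := (List.suffix_of_suffix_length_le hs' hs (by simp)).eq_of_length (by simp)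
      simp only [List.cons.injEq, Prod.mk.injEq, true_and, and_true] at this
      exact hm this
    refine C.ofDendriteFun_of_not_isSuffix y ?_ hns
    rintro ⟨w, hw⟩
    have h1 := C.length_word w
    have h2 := hs.length_le
    rw [hw] at h1
    simp only [List.length_cons] at h1 h2
    have hw0 : w = [] := List.length_eq_zero_iff.1 (by omega)
    subst hw0
    exact hns (hw ▸ List.suffix_rfl)
  by_cases hb : (r, n) :: b ∈ range C.word
  · obtain ⟨w, hw⟩ := hb
    cases w with
    | nil => exact hsuffix (hw ▸ List.suffix_rfl)
    | cons z w =>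
      rw [← hw, Ne, C.ofDendriteFun_cons_eq_zero_iff] at h
      obtain ⟨s, k⟩ := z
      simp only [word, List.cons.injEq, Prod.mk.injEq] at hw
      obtain ⟨⟨rfl, rfl⟩, rfl⟩ := hw
      obtain ⟨h1, h2⟩ := hy w s k h
      refine ⟨?_, fun m hm => ?_⟩
      · rw [C.ofDendriteFun_word, C.affine_coe, h1]
        push_cast
        ring
      · exact (C.ofDendriteFun_cons_eq_zero_iff y (s, m) w).2 (h2 m hm)
  · by_cases hs : (r, n) :: b <:+ C.base
    · exact hsuffix hs
    · exact absurd (C.ofDendriteFun_of_not_isSuffix y hb hs) h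

theorem ofDendriteFun_mem_nhd {y : DendriteWord → unitInterval} (hy : y ∈ wazewskiDendrite) :
    (⟨C.ofDendriteFun y, C.ofDendriteFun_mem hy⟩ : wazewskiDendrite) ∈ C.nhd := by
  refine ⟨fun w => ?_, fun b hs hb => C.ofDendriteFun_of_not_isSuffix y hb hs⟩
  simp only [C.ofDendriteFun_word]
  have h1 := mul_le_mul_of_nonneg_right (y w).2.2 (C.width_pos w).le
  have h2 := mul_nonneg (y w).2.1 (C.width_pos w).le
  constructor <;> linarith

/-- The neighborhood is a copy of the dendrite. -/
theorem nonempty_homeomorph_nhd : Nonempty (wazewskiDendrite ≃ₜ C.nhd) := by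
  have : CompactSpace C.nhd := isCompact_iff_compactSpace.1 C.isClosed_nhd.isCompact
  let f : C.nhd → wazewskiDendrite := fun x => ⟨C.toDendriteFun x, C.toDendriteFun_mem x⟩
  have hf : Continuous f := by
    refine Continuous.subtype_mk (continuous_pi fun w => Continuous.subtype_mk ?_ _) _
    refine (Continuous.sub ?_ continuous_const).div_const _
    exact continuous_subtype_val.comp ((continuous_apply (C.word w)).comp
      (continuous_subtype_val.comp continuous_subtype_val))
  have hbij : Function.Bijective f := by
    refine ⟨fun x y h => C.toDendriteFun_injective (congrArg Subtype.val h), fun y => ?_⟩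
    refine ⟨⟨_, C.ofDendriteFun_mem_nhd y.2⟩, Subtype.ext (funext fun w => Subtype.ext ?_)⟩
    simp only [f, toDendriteFun, C.ofDendriteFun_word]
    rw [add_sub_cancel_left, mul_div_cancel_right₀ _ (C.width_pos w).ne']
  exact ⟨((isHomeomorph_iff_continuous_bijective.2 ⟨hf, hbij⟩).homeomorph f).symm⟩

end DendriteCut

end Dendrite

/-! ### Small dendrite neighborhoods of subcontinua -/

section Dendrite

open Topology

theorem continuous_dendriteParam (b : DendriteWord) :
    Continuous fun x : wazewskiDendrite => (x.1 b : ℝ) :=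
  continuous_subtype_val.comp ((continuous_apply b).comp continuous_subtype_val)

/-- A point outside of a subcontinuum is separated from it by a rational bound for the parameter at
some arc. -/
theorem exists_rat_separating {K : Set wazewskiDendrite} (hK : IsCompact K)
    (hKc : IsPreconnected K) (hne : K.Nonempty) {x : wazewskiDendrite} (hx : x ∉ K) :
    ∃ (b : DendriteWord) (s : ℚ), ((∀ y ∈ K, (y.1 b : ℝ) < s) ∧ (s : ℝ) < x.1 b) ∨
      ((∀ y ∈ K, (s : ℝ) < y.1 b) ∧ (x.1 b : ℝ) < s) := by
  obtain ⟨b, hb⟩ : ∃ b, ∀ y ∈ K, y.1 b ≠ x.1 b := by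
    by_contra! h
    exact hx (mem_of_forall_exists_apply_eq hK.isClosed hKc x h)
  have hcont := continuous_dendriteParam b
  have himg : IsPreconnected ((fun y : wazewskiDendrite => (y.1 b : ℝ)) '' K) :=
    hKc.image _ hcont.continuousOn
  obtain ⟨y₁, hy₁, hmax⟩ := hK.exists_isMaxOn hne hcont.continuousOn
  obtain ⟨y₀, hy₀, hmin⟩ := hK.exists_isMinOn hne hcont.continuousOn
  refine ⟨b, ?_⟩
  rcases lt_or_ge (y₁.1 b : ℝ) (x.1 b) with h1 | h1
  · obtain ⟨s, hs1, hs2⟩ := exists_rat_btwn h1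
    exact ⟨s, Or.inl ⟨fun y hy => (hmax hy).trans_lt hs1, hs2⟩⟩
  · rcases lt_or_ge (x.1 b : ℝ) (y₀.1 b) with h0 | h0
    · obtain ⟨s, hs1, hs2⟩ := exists_rat_btwn h0
      exact ⟨s, Or.inr ⟨fun y hy => hs2.trans_le (hmin hy), hs1⟩⟩
    -- The parameters of `K` at `b` fill an interval, so a value between its extremes would be
    -- attained.
    · obtain ⟨y, hy, hyx⟩ := himg.Icc_subset (mem_image_of_mem _ hy₀) (mem_image_of_mem _ hy₁)
        ⟨h0, h1⟩
      exact absurd (Subtype.ext hyx) (hb y hy)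

/-- An open neighborhood of a subcontinuum contains the set given by finitely many rational bounds
for the parameters, all of them satisfied strictly by the points of the subcontinuum. -/
theorem exists_finset_bounds {K U : Set wazewskiDendrite} (hK : IsCompact K)
    (hKc : IsPreconnected K) (hne : K.Nonempty) (hU : IsOpen U) (hKU : K ⊆ U) :
    ∃ T L : Finset (DendriteWord × ℚ), (∀ i ∈ T, ∀ y ∈ K, (y.1 i.1 : ℝ) < i.2) ∧
      (∀ i ∈ L, ∀ y ∈ K, (i.2 : ℝ) < y.1 i.1) ∧
      ∀ x : wazewskiDendrite, (∀ i ∈ T, (x.1 i.1 : ℝ) ≤ i.2) → (∀ i ∈ L, (i.2 : ℝ) ≤ x.1 i.1) →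
        x ∈ U := by
  classical
  let ι := {i : DendriteWord × ℚ // ∀ y ∈ K, (y.1 i.1 : ℝ) < i.2} ⊕
    {i : DendriteWord × ℚ // ∀ y ∈ K, (i.2 : ℝ) < y.1 i.1}
  let O : ι → Set wazewskiDendrite := Sum.elim (fun i => {x | (i.1.2 : ℝ) < x.1 i.1.1})
    (fun i => {x | (x.1 i.1.1 : ℝ) < i.1.2})
  have hO : ∀ i, IsOpen (O i) := by
    rintro (i | i)
    · exact isOpen_lt continuous_const (continuous_dendriteParam _)
    · exact isOpen_lt (continuous_dendriteParam _) continuous_const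
  obtain ⟨t, ht⟩ := hU.isClosed_compl.isCompact.elim_finite_subcover O hO fun x hx => by
    obtain ⟨b, s, h | h⟩ := exists_rat_separating hK hKc hne fun hxK => hx (hKU hxK)
    · exact mem_iUnion.2 ⟨Sum.inl ⟨(b, s), h.1⟩, h.2⟩
    · exact mem_iUnion.2 ⟨Sum.inr ⟨(b, s), h.1⟩, h.2⟩
  refine ⟨t.toLeft.image Subtype.val, t.toRight.image Subtype.val, ?_, ?_, fun x hxT hxL => ?_⟩
  · intro i hi
    obtain ⟨j, -, rfl⟩ := Finset.mem_image.1 hi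
    exact j.2
  · intro i hi
    obtain ⟨j, -, rfl⟩ := Finset.mem_image.1 hi
    exact j.2
  · by_contra hxU
    obtain ⟨i | i, hi, hxi⟩ := mem_iUnion₂.1 (ht hxU)
    · exact (hxT i.1 (Finset.mem_image_of_mem _ (Finset.mem_toLeft.2 hi))).not_gt hxi
    · exact (hxL i.1 (Finset.mem_image_of_mem _ (Finset.mem_toRight.2 hi))).not_gt hxi

/-- Every subcontinuum of Ważewski's dendrite has arbitrarily small closed neighborhoods that are
copies of the whole dendrite. -/
theorem exists_wazewskiDendrite_nhd {K U : Set wazewskiDendrite} (hK : IsCompact K)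
    (hKc : IsPreconnected K) (hne : K.Nonempty) (hU : IsOpen U) (hKU : K ⊆ U) :
    ∃ P : Set wazewskiDendrite, IsClosed P ∧ K ⊆ interior P ∧ P ⊆ U ∧
      Nonempty (wazewskiDendrite ≃ₜ P) := by
  classical
  obtain ⟨T, L, hT, hL, hTLU⟩ := exists_finset_bounds hK hKc hne hU hKU
  obtain ⟨y₀, hy₀⟩ := hne
  -- The upper bounds at each arc are merged into their minimum, capped by `1`.
  let Q : DendriteWord → Finset ℚ := fun b => insert 1 ((T.filter (·.1 = b)).image (·.2))
  have hQne : ∀ b, (Q b).Nonempty := fun b => Finset.insert_nonempty _ _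
  let high : DendriteWord → ℚ := fun b => (Q b).min' (hQne b)
  have hhigh : ∀ b, high b = 1 ∨ (b, high b) ∈ T := by
    intro b
    rcases Finset.mem_insert.1 ((Q b).min'_mem (hQne b)) with h | h
    · exact Or.inl h
    · obtain ⟨⟨c, s⟩, hi, hs⟩ := Finset.mem_image.1 h
      obtain ⟨hiT, hc⟩ := Finset.mem_filter.1 hi
      have hcs : (c, s) = (b, high b) := Prod.ext hc hs
      exact Or.inr (hcs ▸ hiT)
  have high_le_one : ∀ b, high b ≤ 1 := fun b =>
    (Q b).min'_le 1 (Finset.mem_insert_self _ _)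
  have high_le : ∀ i ∈ T, high i.1 ≤ i.2 := fun i hi => (Q i.1).min'_le _
    (Finset.mem_insert_of_mem (Finset.mem_image.2 ⟨i, Finset.mem_filter.2 ⟨hi, rfl⟩, rfl⟩))
  have hKhigh : ∀ b, high b < 1 → ∀ y ∈ K, (y.1 b : ℝ) < high b := fun b hb =>
    hT _ ((hhigh b).resolve_left hb.ne)
  have hyhigh : ∀ b, (y₀.1 b : ℝ) ≤ high b := by
    intro b
    rcases (high_le_one b).lt_or_eq with h | h
    · exact (hKhigh b h y₀ hy₀).le
    · rw [h, Rat.cast_one]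
      exact (y₀.1 b).2.2
  have high_pos : ∀ b, 0 < high b := by
    intro b
    rcases (high_le_one b).lt_or_eq with h | h
    · have := (y₀.1 b).2.1.trans_lt (hKhigh b h y₀ hy₀)
      exact_mod_cast this
    · rw [h]
      exact one_pos
  -- A single lower bound suffices: arcs with positive lower bounds lie on the path to `y₀`, hence
  -- form a chain, and entering the deepest one prescribes the parameters on the others. The
  -- lexicographic maximum picks the deepest arc and its largest bound.
  obtain ⟨a, p, hp0, hap, hKp, hmax⟩ : ∃ (a : DendriteWord) (p : ℚ), 0 ≤ p ∧ (p = 0 → a = []) ∧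
      (p = 0 ∨ ∀ y ∈ K, (p : ℝ) < y.1 a) ∧
      ∀ i ∈ L, 0 < i.2 → 0 < p ∧ i.1.length ≤ a.length ∧ (i.1.length = a.length → i.2 ≤ p) := by
    by_cases hL' : (L.filter (0 < ·.2)).Nonempty
    · obtain ⟨⟨a, p⟩, hi, hmax⟩ := Finset.exists_max_image _
        (fun i : DendriteWord × ℚ => toLex (i.1.length, i.2)) hL'
      obtain ⟨hiL, hp⟩ := Finset.mem_filter.1 hi
      refine ⟨a, p, le_of_lt hp, fun h => absurd h (ne_of_gt hp), Or.inr (hL _ hiL),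
        fun j hj hj0 => ⟨hp, ?_⟩⟩
      have := hmax j (Finset.mem_filter.2 ⟨hj, hj0⟩)
      rw [Prod.Lex.toLex_le_toLex] at this
      rcases this with h | h
      · exact ⟨le_of_lt h, fun h' => absurd h' (ne_of_lt h)⟩
      · exact ⟨le_of_eq h.1, fun _ => h.2⟩
    · refine ⟨[], 0, le_rfl, fun _ => rfl, Or.inl rfl, fun i hi hi0 => ?_⟩
      exact absurd ⟨i, Finset.mem_filter.2 ⟨hi, hi0⟩⟩ hL'
  have hlow_lt : p < high a := by
    rcases hKp with h | h
    · rw [h]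
      exact high_pos a
    · have := (h y₀ hy₀).trans_le (hyhigh a)
      exact_mod_cast this
  let C : DendriteCut := ⟨a, p, high, hp0, hlow_lt, high_pos, high_le_one, hap⟩
  have hsuffix : ∀ x ∈ C.nhd, ∀ b, b <:+ a → b ≠ a → x.1 b = y₀.1 b := by
    intro x hx b hb hba
    have ha : C.base ≠ [] := by
      rintro h0
      change a = [] at h0
      subst h0
      exact hba (List.suffix_nil.1 hb)
    have hy : (C.low : ℝ) ≤ y₀.1 C.base := by
      rcases hKp with h | h
      · exact absurd (hap h) ha
      · exact (h y₀ hy₀).le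
    exact eq_of_isSuffix x.2 y₀.2 hb hba
      (DendriteCut.apply_base_ne_zero (DendriteCut.low_le_apply hx) ha)
      (DendriteCut.apply_base_ne_zero hy ha)
  refine ⟨C.nhd, C.isClosed_nhd, ?_, fun x hx => hTLU x (fun i hi => ?_) fun i hi => ?_,
    C.nonempty_homeomorph_nhd⟩
  -- Only finitely many of the bounds are nontrivial, and `K` satisfies them strictly.
  · have hopen : IsOpen ({x : wazewskiDendrite | p = 0 ∨ (p : ℝ) < x.1 a} ∩
        ⋂ i ∈ {i | i ∈ T ∧ high i.1 < 1}, {x : wazewskiDendrite | (x.1 i.1 : ℝ) < high i.1}) := by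
      refine IsOpen.inter ?_ ?_
      · exact (isOpen_const (p := p = 0)).union
          (isOpen_lt continuous_const (continuous_dendriteParam a))
      · exact (T.finite_toSet.subset fun i hi => hi.1).isOpen_biInter fun i _ =>
          isOpen_lt (continuous_dendriteParam _) continuous_const
    refine subset_trans (fun y hy => ?_) (interior_maximal (fun x hx => ?_) hopen)
    · exact ⟨hKp.imp_right fun h => h y hy, mem_iInter₂.2 fun i hi => hKhigh _ hi.2 y hy⟩
    · refine DendriteCut.mem_nhd_of_lt hx.1 fun b hb => ?_
      exact mem_iInter₂.1 hx.2 (b, high b) ⟨(hhigh b).resolve_left (ne_of_lt hb), hb⟩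
  · have hle : (high i.1 : ℝ) ≤ i.2 := by exact_mod_cast high_le i hi
    by_cases hb : i.1 ∈ range C.word
    · obtain ⟨w, hw⟩ := hb
      have := (hx.1 w).2
      rw [hw] at this
      exact this.trans hle
    · by_cases hs : i.1 <:+ a
      · have hne : i.1 ≠ a := fun h0 => hb ⟨[], h0.symm⟩
        rw [hsuffix x hx _ hs hne]
        exact (hT i hi y₀ hy₀).le
      · rw [hx.2 _ hs hb]
        exact le_trans (Rat.cast_nonneg.2 (high_pos i.1).le) hle
  · rcases le_or_gt i.2 0 with h0 | h0
    · exact le_trans (by exact_mod_cast h0) (x.1 i.1).2.1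
    · obtain ⟨hp, hlen, hple⟩ := hmax i hi h0
      have hya : y₀.1 a ≠ 0 := fun h => by
        have := (hKp.resolve_left hp.ne') y₀ hy₀
        rw [h, Icc.coe_zero] at this
        exact absurd this (by exact_mod_cast hp.le.not_gt)
      have hyi : y₀.1 i.1 ≠ 0 := fun h => by
        have := hL i hi y₀ hy₀
        rw [h, Icc.coe_zero] at this
        exact absurd this (by exact_mod_cast h0.le.not_gt)
      have hs : i.1 <:+ a := by
        rcases isSuffix_or_isSuffix y₀.2 hyi hya with h | h
        · exact h
        · rw [h.eq_of_length (le_antisymm h.length_le hlen)]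
      by_cases hia : i.1 = a
      · have h1 : (i.2 : ℝ) ≤ p := by exact_mod_cast hple (congrArg List.length hia)
        rw [hia]
        exact h1.trans (DendriteCut.low_le_apply hx)
      · rw [hsuffix x hx _ hs hia]
        exact (hL i hi y₀ hy₀).le

theorem compactifiable_of_containsCopy_wazewskiDendrite (F : Set (Compacts wazewskiDendrite))
    (hF : AnalyticSet F) (hFc : F ⊆ continua wazewskiDendrite)
    (h : ContainsCopy F wazewskiDendrite) : Compactifiable (spacesOf F) := by
  refine compactifiable_of_hasCopyNhds hF fun K hK => hasCopyNhds_of_nonempty hK fun hne => ?_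
  intro U hU hKU
  obtain ⟨P, hP, hKP, hPU, ⟨e⟩⟩ := exists_wazewskiDendrite_nhd K.isCompact
    (closure_minimal hFc (isClosed_continua _) hK) hne hU hKU
  obtain ⟨L, hL, ⟨e'⟩⟩ := h
  exact ⟨P, hP, hKP, hPU, L, hL, ⟨e'.trans e⟩⟩

end Dendrite

theorem mainTheorem7 :
    -- the general theorem
    (∀ (X : Type u) [MetricSpace X] [CompactSpace X] (𝒜 : ℕ → Set (Set X)),
      (∀ n, (𝒜 n).Finite) →
      (∀ n, ∀ A ∈ 𝒜 n, IsClosed A ∧ Metric.diam A < (2 : ℝ)⁻¹ ^ n) →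
      (∀ n, ⋃₀ 𝒜 n = univ) →
      ∀ F : Set (Compacts X), IsGδ F →
        (∀ K ∈ closure F, ∀ n, ContainsCopy F (coverStar (𝒜 n) (K : Set X))) →
        Compactifiable (spacesOf F)) ∧
    -- analytic families of continua in the Hilbert cube
    (∀ F : Set (continua HilbertCube), AnalyticSet F →
      (∀ (Y : Type) [TopologicalSpace Y], IsPeanoContinuum Y →
        ContainsCopy (Subtype.val '' F) Y) →
      Compactifiable (spacesOf (Subtype.val '' F))) ∧
    -- the class of all Peano continua
    Compactifiable {Y : TopCat.{v} | IsPeanoContinuum Y} ∧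
    -- analytic families of compacta in the Cantor space
    (∀ F : Set (Compacts CantorSpace), AnalyticSet F → ContainsCopy F CantorSpace →
      Compactifiable (spacesOf F)) ∧
    -- families of continua in Ważewski's universal dendrite
    (∀ F : Set (continua wazewskiDendrite), IsGδ F →
      ContainsCopy (Subtype.val '' F) wazewskiDendrite →
      Compactifiable (spacesOf (Subtype.val '' F))) := by
  refine ⟨fun X _ _ 𝒜 hfin hcl hcov F hF h =>
      compactifiable_of_coverStar 𝒜 hfin hcl hcov F hF.analyticSet h,
    fun F hF h => compactifiable_of_containsCopy_peano _
      (hF.image_of_continuous continuous_subtype_val) (Subtype.coe_image_subset _ _) h,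
    compactifiable_isPeanoContinuum, compactifiable_of_containsCopy_cantor, fun F hF h => ?_⟩
  have := polishSpace_compacts wazewskiDendrite
  have : PolishSpace (continua wazewskiDendrite) := (isClosed_continua _).polishSpace
  exact compactifiable_of_containsCopy_wazewskiDendrite _
    (hF.analyticSet.image_of_continuous continuous_subtype_val) (Subtype.coe_image_subset _ _) h
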